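/- Let $k\ge 1$ and $n\ge 0$ be integers, let $M^k$ be a compact smooth ($C^\infty$) manifold with (possibly empty) boundary, and let $x:M\to\mathbb R^{n+1}$ be a smooth immersion with $x(M)\subset \overline{B}$ and $x(\partial M)\subset\partial B$, where $B=\{|x|<1\}$ is the open unit ball centred at the origin. Assume that $x$ is minimal, i.e. its mean curvature vector $\vec H=\frac1k\operatorname{tr}_g\sigma$ vanishes identically, where $g$ is the metric induced by $x$ and $\sigma(X,Y)=(D_XY)^\perp$ is the second fundamental form; and that $M$ has free boundary, i.e. it meets the unit sphere orthogonally: $\nu=x$ along $\partial M$, where $\nu$ is the outward unit conormal of $\partial M$ in $M$. Let $da$ be the area measure of $g$. Then $M$ has finite area, $x$ is integrable, and the mass center of $M$ is at the origin: $$\int_M x\,da=0,\qquad\text{hence}\qquad \frac{1}{|M|}\int_M x\,da=0 \quad (M\neq\emptyset).$$ -/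

import Mathlib

open scoped Manifold ContDiff Topology

noncomputable section

/-- Euclidean space `ℝᵈ` with its standard inner product. -/
abbrev Euc (d : ℕ) : Type := EuclideanSpace ℝ (Fin d)

namespace FreeBoundary

section Coordinates

/-! ### A piece of a submanifold, given by a parametrization

`u` is a parametrization defined (at least) near a point `y` of the closed half-space
`{y | 0 ≤ y 0} = range (𝓡∂ k)` of `ℝᵏ`; derivatives are taken within that half-space, so that they
are one-sided at boundary points. -/

variable {k d : ℕ} [NeZero k]

/-- The coordinate tangent vector `∂ᵢu(y)`. -/
def coordVector (u : Euc k → Euc d) (y : Euc k) (i : Fin k) : Euc d :=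
  fderivWithin ℝ u (Set.range (𝓡∂ k)) y (EuclideanSpace.single i 1)

/-- The second partial derivative `∂ᵢ∂ⱼu(y)`. -/
def coordSecondDeriv (u : Euc k → Euc d) (y : Euc k) (i j : Fin k) : Euc d :=
  fderivWithin ℝ (fun z => fderivWithin ℝ u (Set.range (𝓡∂ k)) z) (Set.range (𝓡∂ k)) y
    (EuclideanSpace.single i 1) (EuclideanSpace.single j 1)

/-- The induced metric `gᵢⱼ = ⟨∂ᵢu, ∂ⱼu⟩`. -/
def inducedMetric (u : Euc k → Euc d) (y : Euc k) : Matrix (Fin k) (Fin k) ℝ :=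
  Matrix.of fun i j => inner ℝ (coordVector u y i) (coordVector u y j)

/-- The tangent space of the piece: the span of the coordinate vectors. -/
def tangentPlane (u : Euc k → Euc d) (y : Euc k) : Submodule ℝ (Euc d) :=
  Submodule.span ℝ (Set.range (coordVector u y))

/-- The (vector-valued) second fundamental form `σ(∂ᵢ, ∂ⱼ) = (D_{∂ᵢ} ∂ⱼu)^⊥ = (∂ᵢ∂ⱼu)^⊥`. -/
def secondFundamentalForm (u : Euc k → Euc d) (y : Euc k) (i j : Fin k) : Euc d :=
  (tangentPlane u y)ᗮ.starProjection (coordSecondDeriv u y i j)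

/-- The mean curvature vector `(1/k) ∑ᵢⱼ gⁱʲ σ(∂ᵢ, ∂ⱼ)`. -/
def meanCurvatureVector (u : Euc k → Euc d) (y : Euc k) : Euc d :=
  (k : ℝ)⁻¹ • ∑ i, ∑ j, (inducedMetric u y)⁻¹ i j • secondFundamentalForm u y i j

/-- The area density `√(det g)`. -/
def areaDensity (u : Euc k → Euc d) (y : Euc k) : ℝ :=
  √(inducedMetric u y).det

end Coordinates

section Immersions

/-! ### Maps from a `k`-dimensional manifold with boundary into `ℝᵈ` -/

variable (k : ℕ) {d : ℕ} [NeZero k] {M : Type*} [TopologicalSpace M]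
  [ChartedSpace (EuclideanHalfSpace k) M]

/-- `x` is a smooth immersion (up to the boundary). -/
structure IsSmoothImmersion (x : M → Euc d) : Prop where
  smooth : ContMDiff (𝓡∂ k) 𝓘(ℝ, Euc d) ∞ x
  injective_mfderiv : ∀ p : M, Function.Injective (mfderiv (𝓡∂ k) 𝓘(ℝ, Euc d) x p)

/-- `x` read in the chart of `M` around `q`: the local parametrization `x ∘ φ_q⁻¹`, meaningful on
`(extChartAt (𝓡∂ k) q).target`. -/
def localParam (x : M → Euc d) (q : M) : Euc k → Euc d :=
  x ∘ (extChartAt (𝓡∂ k) q).symm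

/-- `x` is minimal: its mean curvature vector vanishes everywhere. The mean curvature vector at a
point does not depend on the chart in which it is computed; it is computed in each chart
`φ_q`, at every point of the image of that chart. -/
def IsMinimal (x : M → Euc d) : Prop :=
  ∀ q : M, ∀ y ∈ (extChartAt (𝓡∂ k) q).target, meanCurvatureVector (localParam k x q) y = 0

/-- `ν` is the outward unit conormal of `∂M` in `M` at the boundary point `p`, as a vector of `ℝᵈ`:
it is the image of an outward pointing tangent vector, it has length one, and it is orthogonal
to `∂M`. The tangent space at `p` is identified with `ℝᵏ` by the chart around `p`, which takes
values in `{y | 0 ≤ y 0}` and maps `∂M` to `{y | y 0 = 0}`; so outward pointing vectors are those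
with `v 0 < 0`, and the vectors tangent to `∂M` are those with `w 0 = 0`. -/
def IsOutwardUnitConormal (x : M → Euc d) (p : M) (ν : Euc d) : Prop :=
  (∃ v : Euc k, v 0 < 0 ∧ (mfderiv (𝓡∂ k) 𝓘(ℝ, Euc d) x p : Euc k →L[ℝ] Euc d) v = ν) ∧
  ‖ν‖ = 1 ∧
  ∀ w : Euc k, w 0 = 0 →
    inner ℝ ν ((mfderiv (𝓡∂ k) 𝓘(ℝ, Euc d) x p : Euc k →L[ℝ] Euc d) w) = 0

/-- `x` maps `M` into the closed unit ball and `∂M` into the unit sphere, and it meets the sphere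
orthogonally along `∂M`: the outward unit conormal at a boundary point `p` is `x p`. -/
structure HasFreeBoundaryInUnitBall (x : M → Euc d) : Prop where
  mem_ball : ∀ p : M, x p ∈ Metric.closedBall (0 : Euc d) 1
  mem_sphere : ∀ p ∈ (𝓡∂ k).boundary M, x p ∈ Metric.sphere (0 : Euc d) 1
  conormal : ∀ p ∈ (𝓡∂ k).boundary M, IsOutwardUnitConormal k x p (x p)

variable [MeasurableSpace M]

/-- The area measure of the part of `M` in the domain of the chart `φ_q`: the measure
`√(det g) dy` on the image of the chart, carried over to `M`. -/
def chartArea (x : M → Euc d) (q : M) : MeasureTheory.Measure M :=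
  (((MeasureTheory.volume : MeasureTheory.Measure (Euc k)).restrict
      (extChartAt (𝓡∂ k) q).target).withDensity
    fun y => ENNReal.ofReal (areaDensity (localParam k x q) y)).map (extChartAt (𝓡∂ k) q).symm

/-- The area measure `da` of the metric that `x` induces on `M`: the least measure which dominates
the area measures of all the chart domains. As these agree on overlaps, it is the measure that
equals `√(det g) dy` in every chart. -/
def areaMeasure (x : M → Euc d) : MeasureTheory.Measure M :=
  ⨆ q : M, chartArea k x q

/-- The mass center `(1/|M|) ∫_M x da`. -/
def massCenter (x : M → Euc d) : Euc d :=
  ⨍ p, x p ∂(areaMeasure k x)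

end Immersions

end FreeBoundary

end

/-!
For a vector `e`, the conformal field `V(x) = 2⟨x, e⟩ x - (1 + |x|²) e` is tangent to the unit
sphere, and `DV(x) v = 2(⟨v, e⟩ x - ⟨v, x⟩ e) + 2⟨x, e⟩ v`. The first summand is skew in `v`, so the
divergence of `V` along any `k`-dimensional submanifold is `2k⟨x, e⟩`. On a minimal submanifold the
integral of the tangential divergence of a field that is orthogonal to the conormal along the
boundary vanishes. If the conormal is `x` itself, `V` is such a field, so `∫ ⟨x, e⟩ da = 0`.

The vanishing is proved in charts: the tangential part of `Y` is `L⁺ Y`, where `L` is the derivative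
of a local parametrization and `L⁺` its Moore–Penrose inverse, and the coordinate divergence of
`√(det g) L⁺ Y` is `√(det g)` times the tangential divergence of `Y` plus a multiple of `⟨H, Y⟩`.
-/

noncomputable section

namespace FreeBoundary

open MeasureTheory Set

section Determinant

variable {E : Type*} [NormedAddCommGroup E] [NormedSpace ℝ E] [FiniteDimensional ℝ E]

theorem contDiff_det {n : ℕ∞ω} :
    ContDiff ℝ n (ContinuousLinearMap.det : (E →L[ℝ] E) → ℝ) := by
  let b := Module.finBasis ℝ E
  have entry (i j) : ContDiff ℝ n fun A : E →L[ℝ] E => LinearMap.toMatrix b b A i j :=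
    (LinearMap.toContinuousLinearMap ((LinearMap.proj j ∘ₗ LinearMap.proj i) ∘ₗ
      (LinearMap.toMatrix b b).toLinearMap ∘ₗ ContinuousLinearMap.coeLM ℝ)).contDiff
  have det_eq (A : E →L[ℝ] E) : A.det = (LinearMap.toMatrix b b A).det :=
    (LinearMap.det_toMatrix b _).symm
  simp only [funext det_eq, Matrix.det_apply']
  exact ContDiff.sum fun σ _ => contDiff_const.mul (contDiff_prod fun i _ => entry _ _)

theorem hasDerivAt_det_one_add_smul (B : E →L[ℝ] E) :
    HasDerivAt (fun t : ℝ => (1 + t • B).det) (LinearMap.trace ℝ E B) 0 := by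
  let b := Module.finBasis ℝ E
  let P := LinearMap.toMatrix b b B
  let p := (1 + (Polynomial.X : Polynomial ℝ) • P.map Polynomial.C).det
  have hp (t : ℝ) : (1 + t • B).det = p.eval t := by
    rw [ContinuousLinearMap.det, ← LinearMap.det_toMatrix b, ← Polynomial.coe_evalRingHom,
      RingHom.map_det]
    congr 1
    ext i j
    simp [P, Matrix.one_apply, apply_ite, LinearMap.toMatrix_one, mul_comm t]
  rw [funext hp, LinearMap.trace_eq_matrix_trace ℝ b,
    ← Matrix.derivative_det_one_add_X_smul]
  exact p.hasDerivAt 0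

theorem fderiv_det_apply {A : E →L[ℝ] E} (hA : A.IsInvertible) (B : E →L[ℝ] E) :
    fderiv ℝ ContinuousLinearMap.det A B = A.det * LinearMap.trace ℝ E (A.inverse ∘L B) := by
  have hline : HasDerivAt (fun t : ℝ => A + t • B) B 0 := by
    simpa using ((hasDerivAt_id (0 : ℝ)).smul_const B).const_add A
  have hdet : HasFDerivAt ContinuousLinearMap.det (fderiv ℝ ContinuousLinearMap.det A)
      (A + (0 : ℝ) • B) := by
    simpa using (contDiff_det.differentiable one_ne_zero A).hasFDerivAt
  have hfactor (t : ℝ) : (A + t • B).det = A.det * (1 + t • (A.inverse ∘L B)).det := by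
    have hcomp : A + t • B = A ∘L (1 + t • (A.inverse ∘L B)) := by
      ext v
      simp [hA.self_apply_inverse]
    rw [hcomp]
    exact LinearMap.det_comp _ _
  refine (hdet.comp_hasDerivAt 0 hline).unique ?_
  exact ((hasDerivAt_det_one_add_smul _).const_mul A.det).congr_of_eventuallyEq
    (Filter.Eventually.of_forall hfactor)

end Determinant

section Pseudoinverse

open ContinuousLinearMap (adjoint)

variable {E F : Type*} [NormedAddCommGroup E] [InnerProductSpace ℝ E] [FiniteDimensional ℝ E]
  [NormedAddCommGroup F] [InnerProductSpace ℝ F] {L : E →L[ℝ] F}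

theorem normDet_pos (hL : Function.Injective L) : 0 < L.normDet :=
  L.normDet_nonneg.lt_of_ne' fun h =>
    (LinearMap.normDet_eq_zero_iff_ker_ne_bot.1 h) (LinearMap.ker_eq_bot.2 hL)

variable [CompleteSpace F]

/-- The Moore–Penrose inverse `L⁺ = (L†L)⁻¹L†` of an injective linear map `L`: the vector `L⁺Y`
represents the orthogonal projection of `Y` to the range of `L`. It is `0` if `L` is not
injective. -/
def pinv (L : E →L[ℝ] F) : F →L[ℝ] E :=
  (adjoint L ∘L L).inverse ∘L adjoint L

theorem isInvertible_adjoint_comp_self (hL : Function.Injective L) :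
    (adjoint L ∘L L).IsInvertible := by
  have hinj : Function.Injective (adjoint L ∘L L) := L.adjoint_comp_self_injective_iff.2 hL
  exact ⟨(LinearEquiv.ofInjectiveEndo (adjoint L ∘L L : E →ₗ[ℝ] E) hinj).toContinuousLinearEquiv,
    rfl⟩

theorem adjoint_comp_self_comp_pinv (hL : Function.Injective L) :
    (adjoint L ∘L L) ∘L pinv L = adjoint L := by
  rw [pinv, ← ContinuousLinearMap.comp_assoc,
    (isInvertible_adjoint_comp_self hL).self_comp_inverse, ContinuousLinearMap.id_comp]

theorem pinv_apply_self (hL : Function.Injective L) (v : E) : pinv L (L v) = v :=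
  (isInvertible_adjoint_comp_self hL).inverse_apply_self v

theorem inner_map_pinv_map (hL : Function.Injective L) (Y : F) (v : E) :
    inner ℝ (L (pinv L Y)) (L v) = inner ℝ Y (L v) := by
  rw [← ContinuousLinearMap.adjoint_inner_left, ← ContinuousLinearMap.adjoint_inner_left,
    ← congr($(adjoint_comp_self_comp_pinv hL) Y)]
  rfl

theorem inner_map_pinv_comm (hL : Function.Injective L) (Y Z : F) :
    inner ℝ (L (pinv L Y)) Z = inner ℝ (L (pinv L Z)) Y := by
  rw [real_inner_comm, ← inner_map_pinv_map hL Z, real_inner_comm, inner_map_pinv_map hL,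
    real_inner_comm]

theorem eq_pinv_of_inner_map (hL : Function.Injective L) {Y : F} {w : E}
    (hw : ∀ v, inner ℝ (L w) (L v) = inner ℝ Y (L v)) : w = pinv L Y := by
  refine hL (sub_eq_zero.1 (inner_self_eq_zero (𝕜 := ℝ).1 ?_))
  rw [← map_sub, map_sub, inner_sub_left, ← map_sub, hw, inner_map_pinv_map hL, sub_self]

theorem pinv_comp (hL : Function.Injective L) {A : E →L[ℝ] E} (hA : A.IsInvertible) :
    pinv (L ∘L A) = A.inverse ∘L pinv L := by
  ext Y
  refine (eq_pinv_of_inner_map (L := L ∘L A) (hL.comp hA.injective) fun v => ?_).symm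
  simp only [ContinuousLinearMap.comp_apply, hA.self_apply_inverse, inner_map_pinv_map hL]

theorem map_pinv_eq_starProjection (hL : Function.Injective L) (Y : F) :
    L (pinv L Y) = L.range.starProjection Y := by
  refine (Submodule.eq_starProjection_of_mem_orthogonal' (LinearMap.mem_range_self _ _) ?_
    (add_sub_cancel (L (pinv L Y)) Y).symm).symm
  rintro _ ⟨v, rfl⟩
  rw [ContinuousLinearMap.coe_coe, inner_sub_right, real_inner_comm, ← inner_map_pinv_map hL,
    real_inner_comm, sub_self]

theorem trace_pinv_comp_comp (hL : Function.Injective L) {A : E →L[ℝ] E} (hA : A.IsInvertible)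
    (B : E →L[ℝ] F) :
    LinearMap.trace ℝ E (pinv (L ∘L A) ∘L B ∘L A) = LinearMap.trace ℝ E (pinv L ∘L B) := by
  rw [pinv_comp hL hA]
  change LinearMap.trace ℝ E ((A.inverse : E →ₗ[ℝ] E) ∘ₗ ((pinv L ∘L B) ∘L A)) = _
  rw [LinearMap.trace_comp_comm']
  congr 1
  ext v
  simp [hA.self_apply_inverse]

theorem trace_pinv_comp_rankOne_comp (L : E →L[ℝ] F) (Y Z : F) :
    LinearMap.trace ℝ E (pinv L ∘L InnerProductSpace.rankOne ℝ Y Z ∘L L) =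
      inner ℝ (L (pinv L Y)) Z := by
  have hrankOne : pinv L ∘L InnerProductSpace.rankOne ℝ Y Z ∘L L =
      InnerProductSpace.rankOne ℝ (pinv L Y) (adjoint L Z) := by
    rw [InnerProductSpace.rankOne_comp, InnerProductSpace.comp_rankOne]
  rw [hrankOne, InnerProductSpace.trace_rankOne, ContinuousLinearMap.adjoint_inner_left,
    real_inner_comm]

theorem map_pinv_of_orthogonal (hL : Function.Injective L) {φ : E →ₗ[ℝ] ℝ} {v : E} (hφv : φ v ≠ 0)
    (hv : ∀ w, φ w = 0 → inner ℝ (L v) (L w) = 0) {Y : F} (hY : inner ℝ Y (L v) = 0) :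
    φ (pinv L Y) = 0 := by
  set c := φ (pinv L Y) / φ v with hc
  have hw : φ (pinv L Y - c • v) = 0 := by simp [hc, hφv]
  have horth := hv _ hw
  have hLv : inner ℝ (L v) (L v) ≠ 0 := by
    rw [Ne, inner_self_eq_zero]
    exact fun h => hφv (by rw [hL (h.trans (map_zero L).symm), map_zero])
  rw [map_sub, map_smul, inner_sub_right, real_inner_comm, inner_map_pinv_map hL, hY,
    inner_smul_right, zero_sub, neg_eq_zero, mul_eq_zero, or_iff_left hLv] at horth
  simpa [hφv] using div_eq_zero_iff.1 horth

/-- The adjoint as a linear map; over `ℝ` conjugate-linear maps are linear. -/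
def adjointL : (E →L[ℝ] F) →L[ℝ] F →L[ℝ] E where
  toFun := adjoint
  map_add' := map_add _
  map_smul' c L := by simp
  cont := adjoint.continuous

theorem hasFDerivAt_adjoint (L : E →L[ℝ] F) :
    HasFDerivAt (fun L : E →L[ℝ] F => adjoint L) adjointL L :=
  (adjointL : (E →L[ℝ] F) →L[ℝ] F →L[ℝ] E).hasFDerivAt

theorem contDiff_adjoint {n : ℕ∞ω} : ContDiff ℝ n fun L : E →L[ℝ] F => adjoint L :=
  (adjointL : (E →L[ℝ] F) →L[ℝ] F →L[ℝ] E).contDiff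

theorem contDiff_adjoint_comp_self {n : ℕ∞ω} :
    ContDiff ℝ n fun L : E →L[ℝ] F => adjoint L ∘L L :=
  contDiff_adjoint.clm_comp contDiff_id

theorem fderiv_adjoint_comp_self_apply (L B : E →L[ℝ] F) :
    fderiv ℝ (fun L : E →L[ℝ] F => adjoint L ∘L L) L B = adjoint L ∘L B + adjoint B ∘L L :=
  congr($(((hasFDerivAt_adjoint L).clm_comp (hasFDerivAt_id L)).fderiv) B)

theorem contDiffAt_pinv (hL : Function.Injective L) {n : ℕ∞ω} :
    ContDiffAt ℝ n (pinv : (E →L[ℝ] F) → F →L[ℝ] E) L := by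
  have hinv : ContDiffAt ℝ n (fun L : E →L[ℝ] F => (adjoint L ∘L L).inverse) L :=
    ContDiffAt.comp (g := ContinuousLinearMap.inverse) L
      (isInvertible_adjoint_comp_self hL).contDiffAt_map_inverse
      (contDiff_adjoint_comp_self (E := E) (F := F)).contDiffAt
  have hadj : ContDiffAt ℝ n (fun L : E →L[ℝ] F => adjoint L) L := contDiff_adjoint.contDiffAt
  exact hinv.clm_comp hadj

theorem fderiv_pinv_apply (hL : Function.Injective L) (B : E →L[ℝ] F) (Y : F) :
    fderiv ℝ pinv L B Y =
      (adjoint L ∘L L).inverse (adjoint B (Y - L (pinv L Y))) - pinv L (B (pinv L Y)) := by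
  have hP := ((contDiffAt_pinv hL).differentiableAt one_ne_zero).hasFDerivAt
  -- Differentiate the normal equation `L†L L⁺ = L†`.
  have hprod := ((hasFDerivAt_adjoint L).clm_comp (hasFDerivAt_id L)).clm_comp hP
  have hnormal : (fun L : E →L[ℝ] F => (adjoint L ∘L L) ∘L pinv L) =ᶠ[𝓝 L]
      fun L => adjoint L := by
    filter_upwards [ContinuousLinearMap.isOpen_injective.mem_nhds hL] with L' hL'
    exact adjoint_comp_self_comp_pinv hL'
  have hderiv : (adjoint L ∘L L) (fderiv ℝ pinv L B Y) +
      (adjoint L (B (pinv L Y)) + adjoint B (L (pinv L Y))) = adjoint B Y := by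
    simpa [adjointL] using congr($((hprod.congr_of_eventuallyEq hnormal.symm).unique
      (hasFDerivAt_adjoint L)) B Y)
  rw [← (isInvertible_adjoint_comp_self hL).inverse_apply_self (fderiv ℝ pinv L B Y),
    eq_sub_of_add_eq hderiv, map_sub (adjoint B), map_sub, map_sub, map_add]
  simp only [pinv, ContinuousLinearMap.comp_apply]
  abel

theorem sqrt_det_adjoint_comp_self (L : E →L[ℝ] F) : √(adjoint L ∘L L).det = L.normDet := by
  rw [← L.normDet_sq]
  exact Real.sqrt_sq L.normDet_nonneg

theorem contDiffAt_normDet (hL : Function.Injective L) {n : ℕ∞ω} :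
    ContDiffAt ℝ n (fun L : E →L[ℝ] F => L.normDet) L := by
  simp only [← sqrt_det_adjoint_comp_self]
  refine (contDiff_det.contDiffAt.comp L contDiff_adjoint_comp_self.contDiffAt).sqrt ?_
  have hsq : L.normDet ^ 2 = (adjoint L ∘L L).det := L.normDet_sq
  exact (hsq ▸ pow_pos (normDet_pos hL) 2 : 0 < (adjoint L ∘L L).det).ne'

theorem trace_adjoint (A : E →L[ℝ] E) :
    LinearMap.trace ℝ E (adjoint A) = LinearMap.trace ℝ E A := by
  simp only [LinearMap.trace_eq_sum_inner _ (stdOrthonormalBasis ℝ E), ContinuousLinearMap.coe_coe,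
    ContinuousLinearMap.adjoint_inner_right, real_inner_comm]

theorem adjoint_pinv (hL : Function.Injective L) :
    adjoint (pinv L) = L ∘L (adjoint L ∘L L).inverse := by
  refine ((ContinuousLinearMap.eq_adjoint_iff _ _).2 fun v Y => ?_).symm
  obtain ⟨w, rfl⟩ := (isInvertible_adjoint_comp_self hL).surjective v
  rw [ContinuousLinearMap.comp_apply, (isInvertible_adjoint_comp_self hL).inverse_apply_self,
    ContinuousLinearMap.comp_apply, ContinuousLinearMap.adjoint_inner_left, real_inner_comm,
    ← inner_map_pinv_map hL, real_inner_comm]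

theorem trace_inverse_comp_adjoint_comp (hL : Function.Injective L) (B : E →L[ℝ] F) :
    LinearMap.trace ℝ E ((adjoint L ∘L L).inverse ∘L adjoint B ∘L L) =
      LinearMap.trace ℝ E (pinv L ∘L B) := by
  rw [← trace_adjoint (pinv L ∘L B), ContinuousLinearMap.adjoint_comp, adjoint_pinv hL]
  exact LinearMap.trace_comp_comm' (adjoint B ∘L L : E →ₗ[ℝ] E)
    ((adjoint L ∘L L).inverse : E →ₗ[ℝ] E)

theorem fderiv_normDet_apply (hL : Function.Injective L) (B : E →L[ℝ] F) :
    fderiv ℝ (fun L : E →L[ℝ] F => L.normDet) L B =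
      L.normDet * LinearMap.trace ℝ E (pinv L ∘L B) := by
  have hsq (L : E →L[ℝ] F) : L.normDet ^ 2 = (adjoint L ∘L L).det := L.normDet_sq
  have hN := ((contDiffAt_normDet hL).differentiableAt one_ne_zero).hasFDerivAt.pow 2
  have hdet : HasFDerivAt (fun L : E →L[ℝ] F => (adjoint L ∘L L).det) _ L :=
    HasFDerivAt.comp (g := ContinuousLinearMap.det) L
      (contDiff_det.differentiable one_ne_zero _).hasFDerivAt
      (contDiff_adjoint_comp_self.differentiable one_ne_zero L).hasFDerivAt
  have hderiv : 2 * L.normDet * fderiv ℝ (fun L : E →L[ℝ] F => L.normDet) L B =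
      L.normDet ^ 2 * (2 * LinearMap.trace ℝ E (pinv L ∘L B)) := by
    have hunique := (hN.congr_of_eventuallyEq (.of_forall fun L => (hsq L).symm)).unique hdet
    calc _ = fderiv ℝ ContinuousLinearMap.det (adjoint L ∘L L)
            (fderiv ℝ (fun L : E →L[ℝ] F => adjoint L ∘L L) L B) := by
          simpa using congr($hunique B)
      _ = (adjoint L ∘L L).det * LinearMap.trace ℝ E
            ((adjoint L ∘L L).inverse ∘L (adjoint L ∘L B + adjoint B ∘L L)) := by
        rw [fderiv_adjoint_comp_self_apply,
          fderiv_det_apply (isInvertible_adjoint_comp_self hL)]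
      _ = _ := by
        rw [ContinuousLinearMap.comp_add, ContinuousLinearMap.toLinearMap_add, map_add,
          trace_inverse_comp_adjoint_comp hL, hsq, two_mul]
        rfl
  refine mul_left_cancel₀ (mul_ne_zero two_ne_zero (normDet_pos hL).ne') ?_
  rw [hderiv]
  ring

theorem hasFDerivWithinAt_pinv_apply {W : Type*} [NormedAddCommGroup W] [NormedSpace ℝ W]
    {L : W → E →L[ℝ] F} {L' : W →L[ℝ] E →L[ℝ] F} {Y : W → F} {Y' : W →L[ℝ] F} {s : Set W} {y : W}
    (hL : HasFDerivWithinAt L L' s y) (hY : HasFDerivWithinAt Y Y' s y)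
    (hinj : Function.Injective (L y)) :
    HasFDerivWithinAt (fun z => pinv (L z) (Y z))
      (pinv (L y) ∘L Y' - pinv (L y) ∘L L'.flip (pinv (L y) (Y y)) +
        (adjoint (L y) ∘L L y).inverse ∘L
          adjointL.flip (Y y - L y (pinv (L y) (Y y))) ∘L L') s y := by
  have hpinv := ((contDiffAt_pinv hinj).differentiableAt one_ne_zero).hasFDerivAt
  refine ((hpinv.comp_hasFDerivWithinAt y hL).clm_apply hY).congr_fderiv ?_
  ext v
  simp only [add_apply, sub_apply, Function.comp_apply,
    ContinuousLinearMap.comp_apply, ContinuousLinearMap.flip_apply, fderiv_pinv_apply hinj]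
  rw [sub_add, ← sub_add, sub_add_eq_add_sub, add_sub_assoc]
  rfl

theorem trace_fderivWithin_normDet_smul_pinv {L : E → E →L[ℝ] F} {L' : E →L[ℝ] E →L[ℝ] F}
    {Y : E → F} {Y' : E →L[ℝ] F} {s : Set E} {y : E} (hs : UniqueDiffWithinAt ℝ s y)
    (hL : HasFDerivWithinAt L L' s y) (hY : HasFDerivWithinAt Y Y' s y)
    (hinj : Function.Injective (L y)) (hsymm : ∀ v w, L' v w = L' w v) :
    LinearMap.trace ℝ E (fderivWithin ℝ (fun z => (L z).normDet • pinv (L z) (Y z)) s y) =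
      (L y).normDet * (LinearMap.trace ℝ E (pinv (L y) ∘L Y') +
        LinearMap.trace ℝ E ((adjoint (L y) ∘L L y).inverse ∘L
          adjointL.flip (Y y - L y (pinv (L y) (Y y))) ∘L L')) := by
  have hdensity := ((contDiffAt_normDet hinj).differentiableAt one_ne_zero).hasFDerivAt
  -- By symmetry of `L'`, the derivative of the density cancels the term `-L⁺ L'(·, X)` of the
  -- derivative of `X = L⁺ Y`.
  have hflip (X : E) : L'.flip X = L' X := ContinuousLinearMap.ext fun v => hsymm v X
  have hfield : HasFDerivWithinAt (fun z => (L z).normDet • pinv (L z) (Y z)) _ s y :=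
    (hdensity.comp_hasFDerivWithinAt y hL).smul (hasFDerivWithinAt_pinv_apply hL hY hinj)
  have htrace (φ : E →L[ℝ] ℝ) (X : E) : LinearMap.trace ℝ E (φ.smulRight X) = φ X :=
    LinearMap.trace_smulRight _ _
  rw [hfield.fderivWithin hs]
  simp only [hflip, ContinuousLinearMap.toLinearMap_add, ContinuousLinearMap.toLinearMap_sub,
    ContinuousLinearMap.toLinearMap_smul, map_add, map_sub, map_smul, Function.comp_apply, htrace,
    ContinuousLinearMap.comp_apply, fderiv_normDet_apply hinj, smul_eq_mul]
  ring

theorem inner_inverse_adjoint_comp_self {ι : Type*} [Fintype ι] [DecidableEq ι]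
    (hL : Function.Injective L) (b : OrthonormalBasis ι ℝ E) (i j : ι) :
    inner ℝ (b i) ((adjoint L ∘L L).inverse (b j)) = (Matrix.gram ℝ (L ∘ b))⁻¹ i j := by
  have hmul : Matrix.gram ℝ (L ∘ b) *
      Matrix.of (fun i j => inner ℝ (b i) ((adjoint L ∘L L).inverse (b j))) = 1 := by
    ext i j
    have hexpand := congr(inner ℝ (adjoint L (L (b i)))
      $(b.sum_repr' ((adjoint L ∘L L).inverse (b j))))
    simp only [inner_sum, inner_smul_right, ContinuousLinearMap.adjoint_inner_left] at hexpand
    simp only [Matrix.mul_apply, Matrix.gram_apply, Matrix.of_apply, Function.comp_apply,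
      mul_comm (inner ℝ (L (b i)) _)]
    rw [hexpand, ← ContinuousLinearMap.adjoint_inner_right, ← ContinuousLinearMap.comp_apply,
      (isInvertible_adjoint_comp_self hL).self_apply_inverse, b.inner_eq_ite, Matrix.one_apply]
  rw [Matrix.inv_eq_right_inv hmul, Matrix.of_apply]

theorem trace_inverse_comp_adjointL_flip_comp {ι : Type*} [Fintype ι] [DecidableEq ι]
    (hL : Function.Injective L) (b : OrthonormalBasis ι ℝ E) (N : F) (L' : E →L[ℝ] E →L[ℝ] F) :
    LinearMap.trace ℝ E ((adjoint L ∘L L).inverse ∘L adjointL.flip N ∘L L') =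
      ∑ i, ∑ j, (Matrix.gram ℝ (L ∘ b))⁻¹ i j * inner ℝ (L' (b i) (b j)) N := by
  rw [LinearMap.trace_eq_sum_inner _ b]
  refine Finset.sum_congr rfl fun i _ => ?_
  change inner ℝ (b i) ((adjoint L ∘L L).inverse (adjoint (L' (b i)) N)) = _
  rw [← b.sum_repr' (adjoint (L' (b i)) N), map_sum, inner_sum]
  refine Finset.sum_congr rfl fun j _ => ?_
  rw [map_smul, inner_smul_right, inner_inverse_adjoint_comp_self hL,
    ContinuousLinearMap.adjoint_inner_right, mul_comm]

end Pseudoinverse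

section Parametrizations

variable {k d : ℕ} [NeZero k] {u : Euc k → Euc d} {y : Euc k}

theorem inducedMetric_eq_gram (u : Euc k → Euc d) (y : Euc k) :
    inducedMetric u y = Matrix.gram ℝ
      (fderivWithin ℝ u (range (𝓡∂ k)) y ∘ EuclideanSpace.basisFun (Fin k) ℝ) := by
  ext i j
  simp [inducedMetric, coordVector, Matrix.gram_apply]

theorem areaDensity_eq_normDet (u : Euc k → Euc d) (y : Euc k) :
    areaDensity u y = (fderivWithin ℝ u (range (𝓡∂ k)) y).normDet := by
  rw [areaDensity, inducedMetric_eq_gram]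
  have hgram := (fderivWithin ℝ u (range (𝓡∂ k)) y : Euc k →ₗ[ℝ] Euc d).normDet_sq_eq_det_gram
    (EuclideanSpace.basisFun (Fin k) ℝ)
  exact (congrArg Real.sqrt hgram.symm).trans (Real.sqrt_sq (LinearMap.normDet_nonneg _))

theorem tangentPlane_eq_range (u : Euc k → Euc d) (y : Euc k) :
    tangentPlane u y = (fderivWithin ℝ u (range (𝓡∂ k)) y).range := by
  rw [LinearMap.range_eq_map, ← (EuclideanSpace.basisFun (Fin k) ℝ).toBasis.span_eq,
    Submodule.map_span, ← Set.range_comp, tangentPlane]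
  congr 2
  ext1 i
  simp [coordVector]

theorem inner_meanCurvatureVector
    (hinj : Function.Injective (fderivWithin ℝ u (range (𝓡∂ k)) y)) (Y : Euc d) :
    k * inner ℝ (meanCurvatureVector u y) Y =
      LinearMap.trace ℝ (Euc k)
        ((ContinuousLinearMap.adjoint (fderivWithin ℝ u (range (𝓡∂ k)) y) ∘L
            fderivWithin ℝ u (range (𝓡∂ k)) y).inverse ∘L
          adjointL.flip (Y - fderivWithin ℝ u (range (𝓡∂ k)) y
            (pinv (fderivWithin ℝ u (range (𝓡∂ k)) y) Y)) ∘L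
          fderivWithin ℝ (fderivWithin ℝ u (range (𝓡∂ k))) (range (𝓡∂ k)) y) := by
  have hnormal : Y - fderivWithin ℝ u (range (𝓡∂ k)) y
      (pinv (fderivWithin ℝ u (range (𝓡∂ k)) y) Y) = (tangentPlane u y)ᗮ.starProjection Y := by
    simp only [map_pinv_eq_starProjection hinj, Submodule.starProjection_orthogonal_val,
      tangentPlane_eq_range]
  rw [trace_inverse_comp_adjointL_flip_comp hinj (EuclideanSpace.basisFun (Fin k) ℝ),
    ← inducedMetric_eq_gram, hnormal, meanCurvatureVector, real_inner_smul_left,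
    mul_inv_cancel_left₀ (NeZero.ne _)]
  simp only [sum_inner, real_inner_smul_left, secondFundamentalForm,
    Submodule.inner_starProjection_left_eq_right, coordSecondDeriv, EuclideanSpace.basisFun_apply]

theorem contDiffWithinAt_fderivWithin_range_model (hy : y ∈ range (𝓡∂ k))
    (hu : ContDiffWithinAt ℝ 2 u (range (𝓡∂ k)) y) :
    ContDiffWithinAt ℝ 1 (fderivWithin ℝ u (range (𝓡∂ k))) (range (𝓡∂ k)) y :=
  hu.fderivWithin_right (𝓡∂ k).uniqueDiffOn (by norm_num) hy

theorem contDiffWithinAt_areaDensity (hy : y ∈ range (𝓡∂ k))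
    (hu : ContDiffWithinAt ℝ 2 u (range (𝓡∂ k)) y)
    (hinj : Function.Injective (fderivWithin ℝ u (range (𝓡∂ k)) y)) :
    ContDiffWithinAt ℝ 1 (areaDensity u) (range (𝓡∂ k)) y := by
  rw [funext (areaDensity_eq_normDet u)]
  exact ContDiffAt.comp_contDiffWithinAt y (contDiffAt_normDet hinj)
    (contDiffWithinAt_fderivWithin_range_model hy hu)

theorem contDiffWithinAt_pinv_fderivWithin (hy : y ∈ range (𝓡∂ k))
    (hu : ContDiffWithinAt ℝ 2 u (range (𝓡∂ k)) y)
    (hinj : Function.Injective (fderivWithin ℝ u (range (𝓡∂ k)) y)) :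
    ContDiffWithinAt ℝ 1 (fun z => pinv (fderivWithin ℝ u (range (𝓡∂ k)) z))
      (range (𝓡∂ k)) y :=
  ContDiffAt.comp_contDiffWithinAt y (contDiffAt_pinv hinj)
    (contDiffWithinAt_fderivWithin_range_model hy hu)

/-- The first variation formula in coordinates: `L⁺ Y`, with `L` the derivative of `u`, is the
tangential part of `Y` in the parametrization `u`. -/
theorem trace_fderivWithin_areaDensity_smul_pinv {Y : Euc k → Euc d} {Y' : Euc k →L[ℝ] Euc d}
    (hy : y ∈ range (𝓡∂ k)) (hu : ContDiffWithinAt ℝ 2 u (range (𝓡∂ k)) y)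
    (hinj : Function.Injective (fderivWithin ℝ u (range (𝓡∂ k)) y))
    (hY : HasFDerivWithinAt Y Y' (range (𝓡∂ k)) y) :
    LinearMap.trace ℝ (Euc k) (fderivWithin ℝ
        (fun z => areaDensity u z • pinv (fderivWithin ℝ u (range (𝓡∂ k)) z) (Y z))
        (range (𝓡∂ k)) y) =
      areaDensity u y * (LinearMap.trace ℝ (Euc k)
          (pinv (fderivWithin ℝ u (range (𝓡∂ k)) y) ∘L Y') +
        k * inner ℝ (meanCurvatureVector u y) (Y y)) := by
  have hL := ((contDiffWithinAt_fderivWithin_range_model hy hu).differentiableWithinAt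
    one_ne_zero).hasFDerivWithinAt
  have hsymm : IsSymmSndFDerivWithinAt ℝ u (range (𝓡∂ k)) y :=
    hu.isSymmSndFDerivWithinAt (by simp) (𝓡∂ k).uniqueDiffOn
      ((𝓡∂ k).range_subset_closure_interior hy) hy
  simp only [areaDensity_eq_normDet]
  rw [trace_fderivWithin_normDet_smul_pinv ((𝓡∂ k).uniqueDiffOn y hy) hL hY hinj
    fun v w => hsymm v w, inner_meanCurvatureVector hinj]

end Parametrizations

section HalfSpace

theorem trace_eq_sum_apply_single {n : ℕ} (A : Euc n →L[ℝ] Euc n) :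
    LinearMap.trace ℝ (Euc n) A = ∑ i, A (EuclideanSpace.single i 1) i := by
  simp [LinearMap.trace_eq_sum_inner _ (EuclideanSpace.basisFun (Fin n) ℝ),
    EuclideanSpace.inner_single_left]

theorem continuous_trace {E : Type*} [NormedAddCommGroup E] [NormedSpace ℝ E]
    [FiniteDimensional ℝ E] :
    Continuous fun A : E →L[ℝ] E => LinearMap.trace ℝ E A.toLinearMap :=
  (LinearMap.trace ℝ E ∘ₗ ContinuousLinearMap.coeLM ℝ).continuous_of_finiteDimensional

theorem setIntegral_box_trace_eq_zero {n : ℕ} {a b : Fin (n + 1) → ℝ} (hab : a ≤ b)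
    {F : Euc (n + 1) → Euc (n + 1)} {F' : Euc (n + 1) → Euc (n + 1) →L[ℝ] Euc (n + 1)}
    (hF : ContinuousOn F (WithLp.ofLp ⁻¹' Icc a b))
    (hF' : ∀ y : Euc (n + 1), (∀ i, y i ∈ Ioo (a i) (b i)) → HasFDerivAt F (F' y) y)
    (hint : IntegrableOn (fun y => LinearMap.trace ℝ _ (F' y).toLinearMap)
      (WithLp.ofLp ⁻¹' Icc a b))
    (hface : ∀ y i, y i = a i ∨ y i = b i → F y i = 0) :
    ∫ y in WithLp.ofLp ⁻¹' Icc a b, LinearMap.trace ℝ _ (F' y).toLinearMap = 0 := by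
  let e : (Fin (n + 1) → ℝ) ≃L[ℝ] Euc (n + 1) := (EuclideanSpace.equiv (Fin (n + 1)) ℝ).symm
  have hvol : MeasurePreserving e := PiLp.volume_preserving_toLp (Fin (n + 1))
  have hemb : MeasurableEmbedding e := e.toHomeomorph.measurableEmbedding
  rw [← hvol.setIntegral_preimage_emb hemb]
  rw [← hvol.integrableOn_comp_preimage hemb] at hint
  simp only [trace_eq_sum_apply_single, Function.comp_def] at hint ⊢
  change IntegrableOn _ (Icc a b) at hint
  have hdiv := integral_divergence_of_hasFDerivAt_off_countable' a b hab (fun i z => F (e z) i)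
    (fun i z => EuclideanSpace.proj i ∘L F' (e z) ∘L e.toContinuousLinearMap) ∅ countable_empty
    (fun i => (EuclideanSpace.proj i : Euc (n + 1) →L[ℝ] ℝ).continuous.comp_continuousOn
      (hF.comp e.continuous.continuousOn fun _ hz => hz))
    (fun z hz i => (EuclideanSpace.proj i : Euc (n + 1) →L[ℝ] ℝ).hasFDerivAt.comp z
      ((hF' (e z) fun i => hz.1 i trivial).comp z e.hasFDerivAt)) hint
  refine hdiv.trans (Finset.sum_eq_zero fun i _ => ?_)
  have hfront (z : Fin n → ℝ) : F (e (i.insertNth (b i) z)) i = 0 :=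
    hface _ i (.inr (Fin.insertNth_apply_same (α := fun _ => ℝ) i (b i) z))
  have hback (z : Fin n → ℝ) : F (e (i.insertNth (a i) z)) i = 0 :=
    hface _ i (.inl (Fin.insertNth_apply_same (α := fun _ => ℝ) i (a i) z))
  simp only [hfront, hback, integral_zero, sub_self]

theorem mem_range_model_iff {k : ℕ} [NeZero k] {y : Euc k} : y ∈ range (𝓡∂ k) ↔ 0 ≤ y 0 := by
  rw [range_modelWithCornersEuclideanHalfSpace, mem_ofPred_eq]

theorem range_model_mem_nhds {k : ℕ} [NeZero k] {y : Euc k} (hy : 0 < y 0) :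
    range (𝓡∂ k) ∈ 𝓝 y := by
  rw [← mem_interior_iff_mem_nhds, interior_range_modelWithCornersEuclideanHalfSpace]
  exact hy

theorem fderivWithin_eq_zero_of_notMem_isClosed {E F : Type*} [NormedAddCommGroup E]
    [NormedSpace ℝ E] [NormedAddCommGroup F] [NormedSpace ℝ F] {f : E → F} {s K : Set E}
    (hK : IsClosed K) (hf : ∀ y ∉ K, f y = 0) {y : E} (hy : y ∉ K) : fderivWithin ℝ f s y = 0 := by
  have hzero : f =ᶠ[𝓝 y] 0 := Filter.mem_of_superset (hK.isOpen_compl.mem_nhds hy) hf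
  rw [hzero.fderivWithin_eq_of_nhds, fderivWithin_zero, Pi.zero_apply]

theorem exists_halfSpace_box {k : ℕ} [NeZero k] {K : Set (Euc k)} (hK : IsCompact K) :
    ∃ a b : Fin k → ℝ, a ≤ b ∧ a 0 = 0 ∧ ∀ y ∈ K, ∀ i, y i < b i ∧ (i ≠ 0 → a i < y i) := by
  obtain ⟨R, hR, hKR⟩ := hK.isBounded.exists_pos_norm_lt
  refine ⟨Function.update (fun _ => -R) 0 0, fun _ => R, ?_, Function.update_self .., ?_⟩
  · exact update_le_iff.2 ⟨hR.le, fun i _ => neg_le_self hR.le⟩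
  · intro y hy i
    have hyi := abs_lt.1 ((PiLp.norm_apply_le y i).trans_lt (hKR y hy))
    exact ⟨hyi.2, fun hi => by simpa only [Function.update_of_ne hi] using hyi.1⟩

theorem setIntegral_range_model_trace_fderivWithin_eq_zero {k : ℕ} [NeZero k]
    {F : Euc k → Euc k} {K : Set (Euc k)} (hK : IsCompact K)
    (hF : ContDiffOn ℝ 1 F (range (𝓡∂ k))) (hFK : ∀ y ∉ K, F y = 0)
    (htan : ∀ y : Euc k, y 0 = 0 → F y 0 = 0) :
    ∫ y in range (𝓡∂ k), LinearMap.trace ℝ _ (fderivWithin ℝ F (range (𝓡∂ k)) y).toLinearMap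
      = 0 := by
  obtain ⟨n, rfl⟩ : ∃ n, k = n + 1 := Nat.exists_eq_succ_of_ne_zero (NeZero.ne k)
  obtain ⟨a, b, hab, ha0, hKab⟩ := exists_halfSpace_box hK
  have hbox : WithLp.ofLp ⁻¹' Icc a b ⊆ range (𝓡∂ (n + 1)) := fun y hy =>
    mem_range_model_iff.2 (ha0 ▸ hy.1 0)
  have hbox_compact : IsCompact (WithLp.ofLp ⁻¹' Icc a b : Set (Euc (n + 1))) :=
    (EuclideanSpace.equiv (Fin (n + 1)) ℝ).toHomeomorph.isCompact_preimage.2 isCompact_Icc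
  rw [setIntegral_eq_of_subset_of_forall_sdiff_eq_zero (𝓡∂ (n + 1)).isClosed_range.measurableSet
    hbox]
  · refine setIntegral_box_trace_eq_zero hab (hF.continuousOn.mono hbox) (fun y hy => ?_) ?_ ?_
    · have hnhds := range_model_mem_nhds (ha0 ▸ (hy 0).1)
      exact (hF.differentiableOn one_ne_zero y
        (mem_of_mem_nhds hnhds)).hasFDerivWithinAt.hasFDerivAt hnhds
    · exact ((continuous_trace.comp_continuousOn (hF.continuousOn_fderivWithin
        (𝓡∂ (n + 1)).uniqueDiffOn le_rfl)).mono hbox).integrableOn_compact hbox_compact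
    · intro y i hyi
      by_cases hyK : y ∈ K
      · have hi : i = 0 := by
          by_contra hi
          rcases hyi with hyi | hyi
          exacts [((hKab y hyK i).2 hi).ne' hyi, (hKab y hyK i).1.ne hyi]
        subst hi
        exact htan y (ha0 ▸ hyi.resolve_right (hKab y hyK 0).1.ne)
      · rw [hFK y hyK, PiLp.zero_apply]
  · rintro y ⟨hyH, hy⟩
    rw [fderivWithin_eq_zero_of_notMem_isClosed hK.isClosed hFK fun hyK => hy ⟨fun i => ?_,
      fun i => (hKab y hyK i).1.le⟩, ContinuousLinearMap.toLinearMap_zero, map_zero]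
    rcases eq_or_ne i 0 with rfl | hi
    exacts [ha0 ▸ mem_range_model_iff.1 hyH, ((hKab y hyK i).2 hi).le]

theorem setIntegral_trace_fderivWithin_eq_zero_of_isOpen {k : ℕ} [NeZero k] {F : Euc k → Euc k}
    {U K : Set (Euc k)} (hU : IsOpen U) (hK : IsCompact K) (hKU : K ⊆ U ∩ range (𝓡∂ k))
    (hF : ContDiffOn ℝ 1 F (U ∩ range (𝓡∂ k)))
    (hFK : ∀ y ∈ U ∩ range (𝓡∂ k), y ∉ K → F y = 0)
    (htan : ∀ y ∈ U ∩ range (𝓡∂ k), y 0 = 0 → F y 0 = 0) :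
    ∫ y in U ∩ range (𝓡∂ k),
      LinearMap.trace ℝ _ (fderivWithin ℝ F (range (𝓡∂ k)) y).toLinearMap = 0 := by
  set T := U ∩ range (𝓡∂ k)
  have hT {y} (hy : y ∈ T) : T ∈ 𝓝[range (𝓡∂ k)] y :=
    Filter.inter_mem (mem_nhdsWithin_of_mem_nhds (hU.mem_nhds hy.1)) self_mem_nhdsWithin
  have hzero : ∀ y ∉ K, T.indicator F y = 0 := fun y hy =>
    indicator_apply_eq_zero.2 fun hyT => hFK y hyT hy
  have heq {y} (hy : y ∈ T) : T.indicator F =ᶠ[𝓝[range (𝓡∂ k)] y] F := by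
    filter_upwards [hT hy] with z hz using indicator_of_mem hz F
  have hsmooth : ContDiffOn ℝ 1 (T.indicator F) (range (𝓡∂ k)) := fun y _ => by
    by_cases hyT : y ∈ T
    · exact ((hF y hyT).mono_of_mem_nhdsWithin (hT hyT)).congr_of_eventuallyEq (heq hyT)
        (indicator_of_mem hyT F)
    · have hev : T.indicator F =ᶠ[𝓝 y] 0 := Filter.mem_of_superset
        (hK.isClosed.isOpen_compl.mem_nhds fun hyK => hyT (hKU hyK)) hzero
      exact (contDiffAt_const.congr_of_eventuallyEq hev).contDiffWithinAt
  rw [← setIntegral_range_model_trace_fderivWithin_eq_zero hK hsmooth hzero fun y hy0 => ?_]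
  · rw [setIntegral_eq_of_subset_of_forall_sdiff_eq_zero
      (𝓡∂ k).isClosed_range.measurableSet inter_subset_right fun y hy => ?_]
    · refine setIntegral_congr_fun
        (hU.measurableSet.inter (𝓡∂ k).isClosed_range.measurableSet) fun y hy => ?_
      simp only [(heq hy).fderivWithin_eq (indicator_of_mem hy F)]
    · rw [fderivWithin_eq_zero_of_notMem_isClosed hK.isClosed hzero fun hyK => hy.2 (hKU hyK),
        ContinuousLinearMap.toLinearMap_zero, map_zero]
  · by_cases hyT : y ∈ T
    · rw [indicator_of_mem hyT, htan y hyT hy0]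
    · rw [indicator_of_notMem hyT, PiLp.zero_apply]

end HalfSpace

section Charts

variable {E H M G : Type*} [NormedAddCommGroup E] [NormedSpace ℝ E] [TopologicalSpace H]
  {I : ModelWithCorners ℝ E H} [TopologicalSpace M] [ChartedSpace H M]
  [NormedAddCommGroup G] [NormedSpace ℝ G] {f : M → G} {p q q' : M}

theorem contDiffWithinAt_comp_extChartAt_symm {n : ℕ∞ω} [IsManifold I n M]
    (hf : ContMDiff I 𝓘(ℝ, G) n f) {y : E} (hy : y ∈ (extChartAt I q).target) :
    ContDiffWithinAt ℝ n (f ∘ (extChartAt I q).symm) (range I) y := by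
  have hcomp : ContMDiffOn 𝓘(ℝ, E) 𝓘(ℝ, G) n (f ∘ (extChartAt I q).symm) (extChartAt I q).target :=
    hf.comp_contMDiffOn (contMDiffOn_extChartAt_symm q)
  exact (contMDiffOn_iff_contDiffOn.1 hcomp y hy).mono_of_mem_nhdsWithin
    (extChartAt_target_mem_nhdsWithin_of_mem hy)

variable (I) in
/-- The derivative of a vector-valued function on a manifold at `p`, with the tangent space at `p`
identified with the model space `E` by the preferred chart around `p`. -/
def modelDeriv (f : M → G) (p : M) : E →L[ℝ] G :=
  mfderiv I 𝓘(ℝ, G) f p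

theorem modelDeriv_eq_zero_of_notMem_tsupport (hp : p ∉ tsupport f) :
    modelDeriv I f p = 0 :=
  (notMem_tsupport_iff_eventuallyEq.1 hp).mfderiv_eq.trans (mfderiv_const (c := (0 : G)))

theorem modelDeriv_sum {ι : Type*} {S : Finset ι} {f : ι → M → G}
    (hf : ∀ i ∈ S, MDifferentiableAt I 𝓘(ℝ, G) (f i) p) :
    modelDeriv I (fun p => ∑ i ∈ S, f i p) p = ∑ i ∈ S, modelDeriv I (f i) p := by
  have hsum : HasMFDerivAt I 𝓘(ℝ, G) (fun p => ∑ i ∈ S, f i p) p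
      (∑ i ∈ S, modelDeriv I (f i) p : E →L[ℝ] G) :=
    ⟨tendsto_finsetSum S fun i hi => (hf i hi).continuousAt,
      HasFDerivWithinAt.fun_sum fun i hi => (hf i hi).hasMFDerivAt.2⟩
  exact hsum.mfderiv

variable [IsManifold I 1 M]

theorem tangentCoordChange_tangentCoordChange (hq : p ∈ (extChartAt I q).source)
    (hq' : p ∈ (extChartAt I q').source) (v : E) :
    tangentCoordChange I q' q p (tangentCoordChange I q q' p v) = v := by
  rw [tangentCoordChange_comp ⟨⟨hq, hq'⟩, hq⟩, tangentCoordChange_self hq]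

theorem isInvertible_tangentCoordChange (hq : p ∈ (extChartAt I q).source)
    (hq' : p ∈ (extChartAt I q').source) : (tangentCoordChange I q q' p).IsInvertible :=
  .of_inverse (g := tangentCoordChange I q' q p)
    (ContinuousLinearMap.ext fun v => tangentCoordChange_tangentCoordChange hq' hq v)
    (ContinuousLinearMap.ext fun v => tangentCoordChange_tangentCoordChange hq hq' v)

theorem inverse_tangentCoordChange (hq : p ∈ (extChartAt I q).source)
    (hq' : p ∈ (extChartAt I q').source) :
    (tangentCoordChange I q q' p).inverse = tangentCoordChange I q' q p :=
  ContinuousLinearMap.inverse_eq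
    (ContinuousLinearMap.ext fun v => tangentCoordChange_tangentCoordChange hq' hq v)
    (ContinuousLinearMap.ext fun v => tangentCoordChange_tangentCoordChange hq hq' v)

theorem hasFDerivWithinAt_comp_extChartAt_symm (hf : MDifferentiableAt I 𝓘(ℝ, G) f p)
    (hq : p ∈ (extChartAt I q).source) :
    HasFDerivWithinAt (f ∘ (extChartAt I q).symm)
      (modelDeriv I f p ∘L tangentCoordChange I q p p)
      (range I) (extChartAt I q p) := by
  have hp := mem_extChartAt_source (I := I) p
  have hchange := hasFDerivWithinAt_tangentCoordChange (I := I) ⟨hq, hp⟩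
  have hfp : HasFDerivWithinAt (f ∘ (extChartAt I p).symm) (modelDeriv I f p)
      (range I) ((extChartAt I p ∘ (extChartAt I q).symm) (extChartAt I q p)) := by
    rw [Function.comp_apply, (extChartAt I q).left_inv hq]
    exact hf.hasMFDerivAt.2
  have hmaps : MapsTo (extChartAt I p ∘ (extChartAt I q).symm) (range I) (range I) :=
    fun y _ => by simp only [Function.comp_apply, extChartAt_coe, mem_range_self]
  have hsource : ∀ᶠ y in 𝓝 (extChartAt I q p),
      (extChartAt I q).symm y ∈ (extChartAt I p).source :=
    (continuousAt_extChartAt_symm' hq).eventually_mem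
      (by simpa only [(extChartAt I q).left_inv hq] using extChartAt_source_mem_nhds (I := I) p)
  refine (hfp.comp _ hchange hmaps).congr_of_eventuallyEq ?_ ?_
  · filter_upwards [nhdsWithin_le_nhds hsource] with y hy
    simp only [Function.comp_apply, (extChartAt I p).left_inv hy]
  · simp only [Function.comp_apply, (extChartAt I p).left_inv hsource.self_of_nhds]

theorem fderivWithin_comp_extChartAt_symm (hf : MDifferentiableAt I 𝓘(ℝ, G) f p)
    (hq : p ∈ (extChartAt I q).source) :
    fderivWithin ℝ (f ∘ (extChartAt I q).symm) (range I) (extChartAt I q p) =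
      modelDeriv I f p ∘L tangentCoordChange I q p p :=
  (hasFDerivWithinAt_comp_extChartAt_symm hf hq).fderivWithin
    (I.uniqueDiffOn _ (extChartAt_target_subset_range q ((extChartAt I q).map_source hq)))

end Charts

section BoundaryCharts

variable {k : ℕ} [NeZero k]

theorem apply_zero_eq_zero_of_mapsTo_halfSpace {f : Euc k → Euc k} {f' : Euc k →L[ℝ] Euc k}
    {y w : Euc k} (hf : HasFDerivWithinAt f f' (range (𝓡∂ k)) y)
    (hmaps : MapsTo f (range (𝓡∂ k)) (range (𝓡∂ k))) (hy : y 0 = 0) (hfy : f y 0 = 0)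
    (hw : w 0 = 0) : f' w 0 = 0 := by
  have hline : HasDerivAt (fun t : ℝ => y + t • w) w 0 := by
    simpa using ((hasDerivAt_id (0 : ℝ)).smul_const w).const_add y
  have hmem (t : ℝ) : y + t • w ∈ range (𝓡∂ k) := mem_range_model_iff.2 (by simp [hy, hw])
  have hcomp : HasDerivAt (fun t : ℝ => f (y + t • w)) (f' w) 0 :=
    hasDerivWithinAt_univ.1 (HasFDerivWithinAt.comp_hasDerivWithinAt (t := range (𝓡∂ k)) 0
      (by simpa using hf) hline.hasDerivWithinAt fun t _ => hmem t)
  have hcoord : HasDerivAt (fun t : ℝ => f (y + t • w) 0) (f' w 0) 0 :=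
    (EuclideanSpace.proj 0 : Euc k →L[ℝ] ℝ).hasFDerivAt.comp_hasDerivAt (0 : ℝ) hcomp
  refine IsLocalMin.hasDerivAt_eq_zero (.of_forall fun t => ?_) hcoord
  simpa [hfy] using mem_range_model_iff.1 (hmaps (hmem t))

variable {M : Type*} [TopologicalSpace M] [ChartedSpace (EuclideanHalfSpace k) M]
  [IsManifold (𝓡∂ k) 1 M] {p q q' : M}

theorem mem_boundary_iff_extChartAt_zero (hq : p ∈ (extChartAt (𝓡∂ k) q).source) :
    p ∈ (𝓡∂ k).boundary M ↔ extChartAt (𝓡∂ k) q p 0 = 0 := by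
  have htarget : extChartAt (𝓡∂ k) q p ∈ (extChartAt (𝓡∂ k) q).target :=
    (extChartAt (𝓡∂ k) q).map_source hq
  have hnonneg := mem_range_model_iff.1 (extChartAt_target_subset_range q htarget)
  rw [extChartAt_source] at hq
  have hinterior : (𝓡∂ k).IsInteriorPoint p ↔ 0 < extChartAt (𝓡∂ k) q p 0 := by
    rw [ModelWithCorners.isInteriorPoint_iff_of_mem_atlas one_ne_zero
      (chart_mem_atlas (EuclideanHalfSpace k) q) hq]
    have hrange : extChartAt (𝓡∂ k) q p ∈ interior (range (𝓡∂ k)) ↔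
        0 < extChartAt (𝓡∂ k) q p 0 := by
      rw [interior_range_modelWithCornersEuclideanHalfSpace, mem_ofPred_eq]
    rw [← hrange]
    exact ⟨fun h => interior_mono (extChartAt_target_subset_range q) h,
      fun h => (chartAt _ q).mem_interior_extend_target ((chartAt _ q).map_source hq) h⟩
  rw [ModelWithCorners.boundary, mem_ofPred_eq, ← not_iff_not,
    ← ModelWithCorners.isInteriorPoint_iff_not_isBoundaryPoint, hinterior]
  exact hnonneg.lt_iff_ne'

theorem tangentCoordChange_apply_zero (hp : p ∈ (𝓡∂ k).boundary M)
    (hq : p ∈ (extChartAt (𝓡∂ k) q).source) (hq' : p ∈ (extChartAt (𝓡∂ k) q').source)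
    {w : Euc k} (hw : w 0 = 0) : tangentCoordChange (𝓡∂ k) q q' p w 0 = 0 := by
  refine apply_zero_eq_zero_of_mapsTo_halfSpace
    (hasFDerivWithinAt_tangentCoordChange (I := 𝓡∂ k) ⟨hq, hq'⟩) (fun y _ => ?_)
    ((mem_boundary_iff_extChartAt_zero hq).1 hp) ?_ hw
  · simp only [Function.comp_apply, extChartAt_coe, mem_range_self]
  · rw [Function.comp_apply, (extChartAt (𝓡∂ k) q).left_inv hq]
    exact (mem_boundary_iff_extChartAt_zero hq').1 hp

end BoundaryCharts

section ImmersionsInCharts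

variable {k d : ℕ} [NeZero k] {M : Type*} [TopologicalSpace M]
  [ChartedSpace (EuclideanHalfSpace k) M] [IsManifold (𝓡∂ k) ∞ M] {x : M → Euc d} {p q : M}

theorem IsSmoothImmersion.fderivWithin_localParam (hx : IsSmoothImmersion k x)
    (hq : p ∈ (extChartAt (𝓡∂ k) q).source) :
    fderivWithin ℝ (localParam k x q) (range (𝓡∂ k)) (extChartAt (𝓡∂ k) q p) =
      modelDeriv (𝓡∂ k) x p ∘L tangentCoordChange (𝓡∂ k) q p p :=
  fderivWithin_comp_extChartAt_symm (hx.smooth.mdifferentiable (by simp) p) hq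

theorem IsSmoothImmersion.injective_fderivWithin_localParam (hx : IsSmoothImmersion k x)
    {y : Euc k} (hy : y ∈ (extChartAt (𝓡∂ k) q).target) :
    Function.Injective (fderivWithin ℝ (localParam k x q) (range (𝓡∂ k)) y) := by
  have hq := (extChartAt (𝓡∂ k) q).map_target hy
  rw [← (extChartAt (𝓡∂ k) q).right_inv hy, hx.fderivWithin_localParam hq]
  exact (hx.injective_mfderiv _).comp
    (isInvertible_tangentCoordChange hq (mem_extChartAt_source _)).injective

theorem IsSmoothImmersion.contDiffWithinAt_localParam (hx : IsSmoothImmersion k x)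
    {y : Euc k} (hy : y ∈ (extChartAt (𝓡∂ k) q).target) :
    ContDiffWithinAt ℝ 2 (localParam k x q) (range (𝓡∂ k)) y :=
  (contDiffWithinAt_comp_extChartAt_symm hx.smooth hy).of_le (by norm_cast)

theorem IsSmoothImmersion.contDiffOn_areaDensity (hx : IsSmoothImmersion k x) (q : M) :
    ContDiffOn ℝ 1 (areaDensity (localParam k x q)) (extChartAt (𝓡∂ k) q).target := fun _ hy =>
  (contDiffWithinAt_areaDensity (extChartAt_target_subset_range q hy)
    (hx.contDiffWithinAt_localParam hy) (hx.injective_fderivWithin_localParam hy)).mono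
    (extChartAt_target_subset_range q)

theorem IsSmoothImmersion.areaDensity_localParam (hx : IsSmoothImmersion k x)
    (hq : p ∈ (extChartAt (𝓡∂ k) q).source) :
    areaDensity (localParam k x q) (extChartAt (𝓡∂ k) q p) =
      (modelDeriv (𝓡∂ k) x p).normDet * |(tangentCoordChange (𝓡∂ k) q p p).det| := by
  rw [areaDensity_eq_normDet, hx.fderivWithin_localParam hq, ContinuousLinearMap.toLinearMap_comp,
    LinearMap.normDet_comp_of_finrank_eq _ _ rfl, LinearMap.normDet_eq_abs_det]

theorem IsSmoothImmersion.abs_det_mul_areaDensity (hx : IsSmoothImmersion k x) {q' : M}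
    (hq : p ∈ (extChartAt (𝓡∂ k) q).source) (hq' : p ∈ (extChartAt (𝓡∂ k) q').source) :
    |(tangentCoordChange (𝓡∂ k) q q' p).det| *
        areaDensity (localParam k x q') (extChartAt (𝓡∂ k) q' p) =
      areaDensity (localParam k x q) (extChartAt (𝓡∂ k) q p) := by
  have hcocycle : tangentCoordChange (𝓡∂ k) q' p p ∘L tangentCoordChange (𝓡∂ k) q q' p =
      tangentCoordChange (𝓡∂ k) q p p := by
    ext1 v
    exact tangentCoordChange_comp ⟨⟨hq, hq'⟩, mem_extChartAt_source _⟩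
  have hdet : (tangentCoordChange (𝓡∂ k) q p p).det =
      (tangentCoordChange (𝓡∂ k) q' p p).det * (tangentCoordChange (𝓡∂ k) q q' p).det := by
    rw [← hcocycle]
    exact LinearMap.det_comp _ _
  rw [hx.areaDensity_localParam hq, hx.areaDensity_localParam hq', hdet, abs_mul]
  ring

end ImmersionsInCharts

section Area

variable {k d : ℕ} [NeZero k] {M : Type*} [TopologicalSpace M]
  [ChartedSpace (EuclideanHalfSpace k) M]

theorem areaDensity_nonneg (u : Euc k → Euc d) (y : Euc k) : 0 ≤ areaDensity u y :=
  Real.sqrt_nonneg _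

theorem measurableSet_extChartAt_target (q : M) :
    MeasurableSet (extChartAt (𝓡∂ k) q).target := by
  rw [extChartAt_target]
  exact ((chartAt (EuclideanHalfSpace k) q).open_target.preimage
    (𝓡∂ k).continuous_symm).measurableSet.inter (𝓡∂ k).isClosed_range.measurableSet

variable [MeasurableSpace M] [BorelSpace M]

theorem aemeasurable_extChartAt_symm (q : M) :
    AEMeasurable (extChartAt (𝓡∂ k) q).symm
      ((volume : Measure (Euc k)).restrict (extChartAt (𝓡∂ k) q).target) :=
  (continuousOn_extChartAt_symm q).aemeasurable (measurableSet_extChartAt_target q)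

theorem measurableSet_extChartAt_image {q : M} {A : Set M} (hA : MeasurableSet A)
    (hAq : A ⊆ (extChartAt (𝓡∂ k) q).source) : MeasurableSet (extChartAt (𝓡∂ k) q '' A) := by
  have hsymm : Measurable ((extChartAt (𝓡∂ k) q).target.domRestrict (extChartAt (𝓡∂ k) q).symm) :=
    (continuousOn_extChartAt_symm q).domRestrict.measurable
  have himage := (measurableSet_extChartAt_target q).subtype_image (hsymm hA)
  rwa [domRestrict_eq, preimage_comp, Subtype.image_preimage_coe,
    ← (extChartAt (𝓡∂ k) q).image_eq_target_inter_inv_preimage hAq] at himage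

theorem chartArea_apply (x : M → Euc d) (q : M) {A : Set M} (hA : MeasurableSet A) :
    chartArea k x q A = ∫⁻ y in extChartAt (𝓡∂ k) q '' (A ∩ (extChartAt (𝓡∂ k) q).source),
      ENNReal.ofReal (areaDensity (localParam k x q) y) := by
  have hpreimage : (extChartAt (𝓡∂ k) q).symm ⁻¹' A ∩ (extChartAt (𝓡∂ k) q).target =
      extChartAt (𝓡∂ k) q '' (A ∩ (extChartAt (𝓡∂ k) q).source) := by
    rw [inter_comm A, (extChartAt (𝓡∂ k) q).image_source_inter_eq', inter_comm]
  rw [chartArea, Measure.map_apply_of_aemeasurable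
    ((aemeasurable_extChartAt_symm q).mono_ac (withDensity_absolutelyContinuous _ _)) hA,
    withDensity_apply', Measure.restrict_restrict' (measurableSet_extChartAt_target q), hpreimage]

theorem chartArea_inter_source (x : M → Euc d) (q : M) {A : Set M} (hA : MeasurableSet A) :
    chartArea k x q (A ∩ (extChartAt (𝓡∂ k) q).source) = chartArea k x q A := by
  rw [chartArea_apply x q hA,
    chartArea_apply x q (hA.inter (isOpen_extChartAt_source q).measurableSet), inter_assoc,
    inter_self]

variable [IsManifold (𝓡∂ k) ∞ M] {x : M → Euc d}

theorem IsSmoothImmersion.chartArea_eq_of_subset (hx : IsSmoothImmersion k x) {q q' : M}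
    {A : Set M} (hA : MeasurableSet A) (hq : A ⊆ (extChartAt (𝓡∂ k) q).source)
    (hq' : A ⊆ (extChartAt (𝓡∂ k) q').source) : chartArea k x q A = chartArea k x q' A := by
  rw [chartArea_apply x q hA, chartArea_apply x q' hA, inter_eq_left.2 hq, inter_eq_left.2 hq']
  set f := extChartAt (𝓡∂ k) q' ∘ (extChartAt (𝓡∂ k) q).symm with hf
  have hfA : ∀ p ∈ A, f (extChartAt (𝓡∂ k) q p) = extChartAt (𝓡∂ k) q' p := fun p hp => by
    rw [hf, Function.comp_apply, (extChartAt (𝓡∂ k) q).left_inv (hq hp)]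
  have himage : extChartAt (𝓡∂ k) q' '' A = f '' (extChartAt (𝓡∂ k) q '' A) := by
    rw [image_image]
    exact (image_congr hfA).symm
  have hrange : extChartAt (𝓡∂ k) q '' A ⊆ range (𝓡∂ k) := by
    rintro _ ⟨p, hp, rfl⟩
    exact extChartAt_target_subset_range q ((extChartAt (𝓡∂ k) q).map_source (hq hp))
  rw [himage, lintegral_image_eq_lintegral_abs_det_fderiv_mul volume
    (measurableSet_extChartAt_image hA hq)
    (f' := fun y => tangentCoordChange (𝓡∂ k) q q' ((extChartAt (𝓡∂ k) q).symm y))]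
  · refine setLIntegral_congr_fun (measurableSet_extChartAt_image hA hq) ?_
    rintro _ ⟨p, hp, rfl⟩
    simp only [hfA p hp, (extChartAt (𝓡∂ k) q).left_inv (hq hp)]
    rw [← hx.abs_det_mul_areaDensity (hq hp) (hq' hp), ENNReal.ofReal_mul (abs_nonneg _)]
  · rintro _ ⟨p, hp, rfl⟩
    rw [(extChartAt (𝓡∂ k) q).left_inv (hq hp)]
    exact (hasFDerivWithinAt_tangentCoordChange ⟨hq hp, hq' hp⟩).mono hrange
  · rintro _ ⟨p, hp, rfl⟩ _ ⟨p', hp', rfl⟩ heq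
    rw [hfA p hp, hfA p' hp'] at heq
    rw [(extChartAt (𝓡∂ k) q').injOn (hq' hp) (hq' hp') heq]

theorem IsSmoothImmersion.areaMeasure_restrict_source (hx : IsSmoothImmersion k x) (q : M) :
    (areaMeasure k x).restrict (extChartAt (𝓡∂ k) q).source = chartArea k x q := by
  have hU : MeasurableSet (extChartAt (𝓡∂ k) q).source :=
    (isOpen_extChartAt_source q).measurableSet
  refine le_antisymm ?_ ?_
  -- The measure on the right-hand side dominates every `chartArea k x q'`, hence their supremum.
  · have hle : areaMeasure k x ≤ (chartArea k x q).restrict (extChartAt (𝓡∂ k) q).source +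
        (⊤ : Measure M).restrict (extChartAt (𝓡∂ k) q).sourceᶜ := by
      refine iSup_le fun q' => Measure.le_iff.2 fun A hA => ?_
      rw [Measure.add_apply, Measure.restrict_apply hA, Measure.restrict_apply hA,
        ← measure_inter_add_sdiff A hU]
      refine add_le_add ?_ ?_
      · rw [← chartArea_inter_source x q' (hA.inter hU), ← hx.chartArea_eq_of_subset
          ((hA.inter hU).inter (isOpen_extChartAt_source q').measurableSet)
          (inter_subset_left.trans inter_subset_right) inter_subset_right]
        exact measure_mono inter_subset_left
      · exact Measure.le_iff'.1 le_top _
    refine (Measure.restrict_mono_measure hle _).trans ?_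
    rw [Measure.restrict_add, Measure.restrict_restrict hU, Measure.restrict_restrict hU,
      inter_self, inter_compl_self, Measure.restrict_empty, add_zero]
    exact Measure.restrict_le_self
  · refine Measure.le_iff.2 fun A hA => ?_
    rw [Measure.restrict_apply hA, ← chartArea_inter_source x q hA]
    exact Measure.le_iff'.1 (le_iSup (chartArea k x) q) _

theorem IsSmoothImmersion.isLocallyFiniteMeasure_areaMeasure (hx : IsSmoothImmersion k x) :
    IsLocallyFiniteMeasure (areaMeasure k x) := by
  refine ⟨fun q => ?_⟩
  have hdensity : ContinuousAt
      (fun p => areaDensity (localParam k x q) (extChartAt (𝓡∂ k) q p)) q :=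
    ((hx.contDiffOn_areaDensity q).continuousOn.comp (continuousOn_extChartAt q)
      (extChartAt (𝓡∂ k) q).mapsTo).continuousAt (extChartAt_source_mem_nhds q)
  set C := areaDensity (localParam k x q) (extChartAt (𝓡∂ k) q q) + 1
  obtain ⟨A, hAsub, hAo, hqA⟩ := mem_nhds_iff.1 (((hdensity.eventually_lt continuousAt_const
    (lt_add_one _)).and ((continuousAt_extChartAt q).eventually_mem
      (Metric.ball_mem_nhds (extChartAt (𝓡∂ k) q q) one_pos))).and
      (extChartAt_source_mem_nhds (I := 𝓡∂ k) q))
  have hAsource : A ⊆ (extChartAt (𝓡∂ k) q).source := fun p hp => (hAsub hp).2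
  have hAball : extChartAt (𝓡∂ k) q '' A ⊆ Metric.ball (extChartAt (𝓡∂ k) q q) 1 := by
    rintro _ ⟨p, hp, rfl⟩
    exact (hAsub hp).1.2
  refine ⟨A, hAo.mem_nhds hqA, ?_⟩
  rw [← inter_eq_left.2 hAsource, ← Measure.restrict_apply hAo.measurableSet,
    hx.areaMeasure_restrict_source, chartArea_apply x q hAo.measurableSet,
    inter_eq_left.2 hAsource]
  calc ∫⁻ y in extChartAt (𝓡∂ k) q '' A, ENNReal.ofReal (areaDensity (localParam k x q) y)
      ≤ ∫⁻ _ in extChartAt (𝓡∂ k) q '' A, ENNReal.ofReal C := by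
        refine setLIntegral_mono' (measurableSet_extChartAt_image hAo.measurableSet hAsource) ?_
        rintro _ ⟨p, hp, rfl⟩
        exact ENNReal.ofReal_le_ofReal (hAsub hp).1.1.le
    _ = ENNReal.ofReal C * volume (extChartAt (𝓡∂ k) q '' A) := setLIntegral_const _ _
    _ < ⊤ := ENNReal.mul_lt_top ENNReal.ofReal_lt_top
        ((measure_mono hAball).trans_lt measure_ball_lt_top)

theorem IsSmoothImmersion.isFiniteMeasure_areaMeasure [CompactSpace M]
    (hx : IsSmoothImmersion k x) : IsFiniteMeasure (areaMeasure k x) :=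
  have := hx.isLocallyFiniteMeasure_areaMeasure
  inferInstance

theorem IsSmoothImmersion.integral_areaMeasure_eq_setIntegral (hx : IsSmoothImmersion k x) {q : M}
    {f : M → ℝ} (hf : Continuous f) (hfq : ∀ p ∉ (extChartAt (𝓡∂ k) q).source, f p = 0) :
    ∫ p, f p ∂(areaMeasure k x) = ∫ y in (extChartAt (𝓡∂ k) q).target,
      areaDensity (localParam k x q) y * f ((extChartAt (𝓡∂ k) q).symm y) := by
  have hdensity : AEMeasurable (fun y => ENNReal.ofReal (areaDensity (localParam k x q) y))
      (volume.restrict (extChartAt (𝓡∂ k) q).target) :=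
    ((hx.contDiffOn_areaDensity q).continuousOn.aemeasurable
      (measurableSet_extChartAt_target q)).ennreal_ofReal
  rw [← setIntegral_eq_integral_of_forall_compl_eq_zero hfq, hx.areaMeasure_restrict_source,
    chartArea, integral_map
    ((aemeasurable_extChartAt_symm q).mono_ac (withDensity_absolutelyContinuous _ _))
    hf.measurable.aestronglyMeasurable,
    integral_withDensity_eq_integral_toReal_smul₀ hdensity (by simp)]
  simp only [smul_eq_mul, ENNReal.toReal_ofReal (areaDensity_nonneg _ _)]

end Area

section TangentialDivergence

variable {k d : ℕ} [NeZero k] {M : Type*} [TopologicalSpace M]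
  [ChartedSpace (EuclideanHalfSpace k) M] {x Y : M → Euc d} {p q : M} {ν : Euc d}

variable (k) in
/-- The divergence `∑ᵢ ⟨D_{eᵢ} Y, eᵢ⟩` of an `ℝᵈ`-valued field `Y` along the immersion `x`, where
`eᵢ` runs over an orthonormal basis of the tangent space. -/
def tangentialDivergence (x Y : M → Euc d) (p : M) : ℝ :=
  LinearMap.trace ℝ (Euc k) (pinv (modelDeriv (𝓡∂ k) x p) ∘L modelDeriv (𝓡∂ k) Y p)

theorem tangentialDivergence_eq_zero_of_notMem_tsupport (hp : p ∉ tsupport Y) :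
    tangentialDivergence k x Y p = 0 := by
  rw [tangentialDivergence, modelDeriv_eq_zero_of_notMem_tsupport hp,
    ContinuousLinearMap.comp_zero, ContinuousLinearMap.toLinearMap_zero, map_zero]

theorem tangentialDivergence_sum {ι : Type*} {S : Finset ι} {Y : ι → M → Euc d}
    (hY : ∀ i ∈ S, MDifferentiableAt (𝓡∂ k) 𝓘(ℝ, Euc d) (Y i) p) :
    tangentialDivergence k x (fun p => ∑ i ∈ S, Y i p) p =
      ∑ i ∈ S, tangentialDivergence k x (Y i) p := by
  simp only [tangentialDivergence, modelDeriv_sum hY, ContinuousLinearMap.comp_finsetSum,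
    ContinuousLinearMap.toLinearMap_sum, map_sum]

theorem IsOutwardUnitConormal.pinv_modelDeriv_apply_zero (hν : IsOutwardUnitConormal k x p ν)
    (hinj : Function.Injective (modelDeriv (𝓡∂ k) x p)) {Z : Euc d} (hZ : inner ℝ Z ν = 0) :
    pinv (modelDeriv (𝓡∂ k) x p) Z 0 = 0 := by
  obtain ⟨⟨v, hv, rfl⟩, -, horth⟩ := hν
  exact map_pinv_of_orthogonal hinj (φ := (EuclideanSpace.proj 0 : Euc k →L[ℝ] ℝ).toLinearMap)
    hv.ne horth hZ

variable [IsManifold (𝓡∂ k) ∞ M]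

theorem IsSmoothImmersion.pinv_fderivWithin_localParam (hx : IsSmoothImmersion k x)
    (hq : p ∈ (extChartAt (𝓡∂ k) q).source) :
    pinv (fderivWithin ℝ (localParam k x q) (range (𝓡∂ k)) (extChartAt (𝓡∂ k) q p)) =
      tangentCoordChange (𝓡∂ k) p q p ∘L pinv (modelDeriv (𝓡∂ k) x p) := by
  have hp := mem_extChartAt_source (I := 𝓡∂ k) p
  rw [hx.fderivWithin_localParam hq, pinv_comp (hx.injective_mfderiv p)
    (isInvertible_tangentCoordChange hq hp), inverse_tangentCoordChange hq hp]

theorem IsSmoothImmersion.pinv_fderivWithin_localParam_apply_zero (hx : IsSmoothImmersion k x)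
    (htan : ∀ p ∈ (𝓡∂ k).boundary M, ∃ ν, IsOutwardUnitConormal k x p ν ∧ inner ℝ (Y p) ν = 0)
    {y : Euc k} (hy : y ∈ (extChartAt (𝓡∂ k) q).target) (hyzero : y 0 = 0) :
    pinv (fderivWithin ℝ (localParam k x q) (range (𝓡∂ k)) y) (localParam k Y q y) 0 = 0 := by
  obtain ⟨p, hq, rfl⟩ : y ∈ extChartAt (𝓡∂ k) q '' (extChartAt (𝓡∂ k) q).source := by
    rwa [(extChartAt (𝓡∂ k) q).image_source_eq_target]
  have hp := (mem_boundary_iff_extChartAt_zero hq).2 hyzero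
  obtain ⟨ν, hν, hYν⟩ := htan p hp
  rw [hx.pinv_fderivWithin_localParam hq, localParam, Function.comp_apply,
    (extChartAt (𝓡∂ k) q).left_inv hq]
  exact tangentCoordChange_apply_zero hp (mem_extChartAt_source p) hq
    (hν.pinv_modelDeriv_apply_zero (hx.injective_mfderiv p) hYν)

theorem IsSmoothImmersion.tangentialDivergence_eq_trace_localParam (hx : IsSmoothImmersion k x)
    (hY : MDifferentiableAt (𝓡∂ k) 𝓘(ℝ, Euc d) Y p) (hq : p ∈ (extChartAt (𝓡∂ k) q).source) :
    tangentialDivergence k x Y p = LinearMap.trace ℝ (Euc k)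
      (pinv (fderivWithin ℝ (localParam k x q) (range (𝓡∂ k)) (extChartAt (𝓡∂ k) q p)) ∘L
        fderivWithin ℝ (localParam k Y q) (range (𝓡∂ k)) (extChartAt (𝓡∂ k) q p)) := by
  have hYq : fderivWithin ℝ (localParam k Y q) (range (𝓡∂ k)) (extChartAt (𝓡∂ k) q p) =
      modelDeriv (𝓡∂ k) Y p ∘L tangentCoordChange (𝓡∂ k) q p p :=
    fderivWithin_comp_extChartAt_symm hY hq
  rw [hx.fderivWithin_localParam hq, hYq]
  exact (trace_pinv_comp_comp (hx.injective_mfderiv p)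
    (isInvertible_tangentCoordChange hq (mem_extChartAt_source p)) _).symm

theorem IsSmoothImmersion.continuous_tangentialDivergence (hx : IsSmoothImmersion k x)
    (hY : ContMDiff (𝓡∂ k) 𝓘(ℝ, Euc d) 1 Y) : Continuous (tangentialDivergence k x Y) := by
  refine continuous_iff_continuousAt.2 fun q => ?_
  have hchart : ContinuousOn (fun y => LinearMap.trace ℝ (Euc k)
      (pinv (fderivWithin ℝ (localParam k x q) (range (𝓡∂ k)) y) ∘L
        fderivWithin ℝ (localParam k Y q) (range (𝓡∂ k)) y).toLinearMap)
      (extChartAt (𝓡∂ k) q).target := by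
    intro y hy
    have hyrange := extChartAt_target_subset_range q hy
    have hpinv := (contDiffWithinAt_pinv_fderivWithin hyrange (hx.contDiffWithinAt_localParam hy)
      (hx.injective_fderivWithin_localParam hy)).continuousWithinAt
    have hYderiv := ((contDiffWithinAt_comp_extChartAt_symm hY hy).fderivWithin_right
      (𝓡∂ k).uniqueDiffOn (m := 0) (by simp) hyrange).continuousWithinAt
    exact (continuous_trace.continuousAt.comp_continuousWithinAt (hpinv.clm_comp hYderiv)).mono
      (extChartAt_target_subset_range q)
  refine ((hchart.comp (continuousOn_extChartAt q) (extChartAt (𝓡∂ k) q).mapsTo).continuousAt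
    (extChartAt_source_mem_nhds q)).congr ?_
  filter_upwards [extChartAt_source_mem_nhds (I := 𝓡∂ k) q] with p hp
  exact (hx.tangentialDivergence_eq_trace_localParam (hY.mdifferentiable one_ne_zero p) hp).symm

theorem IsSmoothImmersion.areaDensity_mul_tangentialDivergence (hx : IsSmoothImmersion k x)
    (hmin : IsMinimal k x) (hY : ContMDiff (𝓡∂ k) 𝓘(ℝ, Euc d) 1 Y) {y : Euc k}
    (hy : y ∈ (extChartAt (𝓡∂ k) q).target) :
    areaDensity (localParam k x q) y *
        tangentialDivergence k x Y ((extChartAt (𝓡∂ k) q).symm y) =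
      LinearMap.trace ℝ (Euc k) (fderivWithin ℝ (fun z => areaDensity (localParam k x q) z •
        pinv (fderivWithin ℝ (localParam k x q) (range (𝓡∂ k)) z) (localParam k Y q z))
        (range (𝓡∂ k)) y) := by
  have hYq : DifferentiableWithinAt ℝ (localParam k Y q) (range (𝓡∂ k)) y :=
    (contDiffWithinAt_comp_extChartAt_symm hY hy).differentiableWithinAt one_ne_zero
  rw [hx.tangentialDivergence_eq_trace_localParam (hY.mdifferentiable one_ne_zero _)
    ((extChartAt (𝓡∂ k) q).map_target hy), (extChartAt (𝓡∂ k) q).right_inv hy,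
    trace_fderivWithin_areaDensity_smul_pinv (extChartAt_target_subset_range q hy)
      (hx.contDiffWithinAt_localParam hy) (hx.injective_fderivWithin_localParam hy)
      hYq.hasFDerivWithinAt, hmin q y hy, inner_zero_left, mul_zero, add_zero]

variable [CompactSpace M] [MeasurableSpace M] [BorelSpace M]

theorem IsSmoothImmersion.integral_tangentialDivergence_eq_zero_of_tsupport_subset
    (hx : IsSmoothImmersion k x) (hmin : IsMinimal k x)
    (hY : ContMDiff (𝓡∂ k) 𝓘(ℝ, Euc d) 1 Y)
    (htan : ∀ p ∈ (𝓡∂ k).boundary M, ∃ ν, IsOutwardUnitConormal k x p ν ∧ inner ℝ (Y p) ν = 0)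
    (hsupp : tsupport Y ⊆ (extChartAt (𝓡∂ k) q).source) :
    ∫ p, tangentialDivergence k x Y p ∂(areaMeasure k x) = 0 := by
  have hYq {y} (hy : y ∈ (extChartAt (𝓡∂ k) q).target) :
      ContDiffWithinAt ℝ 1 (localParam k Y q) (range (𝓡∂ k)) y :=
    contDiffWithinAt_comp_extChartAt_symm hY hy
  rw [hx.integral_areaMeasure_eq_setIntegral (hx.continuous_tangentialDivergence hY)
      fun p hp => tangentialDivergence_eq_zero_of_notMem_tsupport fun hpY => hp (hsupp hpY),
    setIntegral_congr_fun (measurableSet_extChartAt_target q)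
      fun y hy => hx.areaDensity_mul_tangentialDivergence hmin hY hy, extChartAt_target]
  refine setIntegral_trace_fderivWithin_eq_zero_of_isOpen
    ((chartAt (EuclideanHalfSpace k) q).open_target.preimage (𝓡∂ k).continuous_symm)
    ((isClosed_tsupport Y).isCompact.image_of_continuousOn ((continuousOn_extChartAt q).mono hsupp))
    ?_ ?_ ?_ ?_ <;> rw [← extChartAt_target]
  · exact (image_mono hsupp).trans (extChartAt (𝓡∂ k) q).image_source_eq_target.subset
  · exact fun y hy => (hx.contDiffOn_areaDensity q y hy).smul
      (((contDiffWithinAt_pinv_fderivWithin (extChartAt_target_subset_range q hy)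
        (hx.contDiffWithinAt_localParam hy) (hx.injective_fderivWithin_localParam hy)).clm_apply
        (hYq hy)).mono (extChartAt_target_subset_range q))
  · intro y hy hysupp
    have hzero : localParam k Y q y = 0 := image_eq_zero_of_notMem_tsupport (f := Y) fun hmem =>
      hysupp ⟨_, hmem, (extChartAt (𝓡∂ k) q).right_inv hy⟩
    rw [hzero, map_zero, smul_zero]
  · intro y hy hyzero
    rw [PiLp.smul_apply, hx.pinv_fderivWithin_localParam_apply_zero htan hy hyzero, smul_zero]

end TangentialDivergence

section FirstVariation

theorem exists_finset_smooth_partition_subordinate_charts (k : ℕ) [NeZero k] (M : Type*)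
    [TopologicalSpace M] [T2Space M] [CompactSpace M] [ChartedSpace (EuclideanHalfSpace k) M]
    [IsManifold (𝓡∂ k) ∞ M] :
    ∃ (S : Finset M) (ρ : M → M → ℝ), (∀ q, ContMDiff (𝓡∂ k) 𝓘(ℝ, ℝ) ∞ (ρ q)) ∧
      (∀ q, tsupport (ρ q) ⊆ (extChartAt (𝓡∂ k) q).source) ∧ ∀ p, ∑ q ∈ S, ρ q p = 1 := by
  obtain ⟨ρ, hρ⟩ := SmoothPartitionOfUnity.exists_isSubordinate_chartAt_source (𝓡∂ k) M
  have hfinite := ρ.locallyFinite.finite_nonempty_of_compact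
  refine ⟨hfinite.toFinset, fun q => ρ q, fun q => (ρ q).contMDiff, fun q => ?_, fun p => ?_⟩
  · rw [extChartAt_source]
    exact hρ q
  · refine ρ.sum_finsupport' p (mem_univ p) fun q hq => hfinite.mem_toFinset.2 ⟨p, ?_⟩
    exact (ρ.mem_finsupport p).1 hq

variable {k d : ℕ} [NeZero k] {M : Type*} [TopologicalSpace M] [T2Space M] [CompactSpace M]
  [MeasurableSpace M] [BorelSpace M] [ChartedSpace (EuclideanHalfSpace k) M]
  [IsManifold (𝓡∂ k) ∞ M] {x Y : M → Euc d}

theorem IsSmoothImmersion.integral_tangentialDivergence_eq_zero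
    (hx : IsSmoothImmersion k x) (hmin : IsMinimal k x)
    (hY : ContMDiff (𝓡∂ k) 𝓘(ℝ, Euc d) 1 Y)
    (htan : ∀ p ∈ (𝓡∂ k).boundary M, ∃ ν, IsOutwardUnitConormal k x p ν ∧ inner ℝ (Y p) ν = 0) :
    ∫ p, tangentialDivergence k x Y p ∂(areaMeasure k x) = 0 := by
  have := hx.isFiniteMeasure_areaMeasure
  obtain ⟨S, ρ, hρ, hsupp, hsum⟩ := exists_finset_smooth_partition_subordinate_charts k M
  have hρY (q : M) : ContMDiff (𝓡∂ k) 𝓘(ℝ, Euc d) 1 (ρ q • Y) :=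
    ((hρ q).of_le (by norm_cast)).smul hY
  have hpartition : (fun p => ∑ q ∈ S, (ρ q • Y) p) = Y := by
    ext1 p
    simp only [Pi.smul_apply', ← Finset.sum_smul, hsum, one_smul]
  have hdiv (p : M) : tangentialDivergence k x Y p =
      ∑ q ∈ S, tangentialDivergence k x (ρ q • Y) p := by
    rw [← tangentialDivergence_sum fun q _ => (hρY q).mdifferentiable one_ne_zero p, hpartition]
  simp only [hdiv]
  rw [integral_finsetSum _ fun q _ => (hx.continuous_tangentialDivergence
    (hρY q)).integrable_of_hasCompactSupport (.of_compactSpace _)]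
  refine Finset.sum_eq_zero fun q _ =>
    hx.integral_tangentialDivergence_eq_zero_of_tsupport_subset hmin (hρY q) (fun p hp => ?_)
      ((tsupport_smul_subset_left (ρ q) Y).trans (hsupp q))
  obtain ⟨ν, hν, hYν⟩ := htan p hp
  exact ⟨ν, hν, by rw [Pi.smul_apply', real_inner_smul_left, hYν, mul_zero]⟩

end FirstVariation

section ConformalField

variable {E F : Type*} [NormedAddCommGroup E] [InnerProductSpace ℝ E] [FiniteDimensional ℝ E]
  [NormedAddCommGroup F] [InnerProductSpace ℝ F]

/-- The vector field `2⟨x, e⟩ x - (1 + |x|²) e`. It is conformal and tangent to the unit sphere. -/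
def conformalField (e x : F) : F :=
  (2 * inner ℝ x e) • x - (1 + ‖x‖ ^ 2) • e

theorem inner_conformalField_self (e : F) {x : F} (hx : ‖x‖ = 1) :
    inner ℝ (conformalField e x) x = 0 := by
  rw [conformalField, inner_sub_left, real_inner_smul_left, real_inner_smul_left,
    real_inner_self_eq_norm_sq, hx, real_inner_comm e x]
  ring

theorem contDiff_conformalField (e : F) {n : ℕ∞ω} : ContDiff ℝ n (conformalField e) :=
  ((contDiff_const.mul (contDiff_id.inner ℝ contDiff_const)).smul contDiff_id).sub
    ((contDiff_const.add (contDiff_id.norm_sq ℝ)).smul contDiff_const)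

theorem hasFDerivAt_conformalField (e x : F) :
    HasFDerivAt (conformalField e)
      ((2 : ℝ) • (InnerProductSpace.rankOne ℝ x e - InnerProductSpace.rankOne ℝ e x) +
        (2 * inner ℝ x e) • ContinuousLinearMap.id ℝ F) x := by
  have hradial := (((hasFDerivAt_id x).inner ℝ (hasFDerivAt_const e x)).const_mul 2).smul
    (hasFDerivAt_id x)
  have hconst := ((hasFDerivAt_id x).norm_sq.const_add 1).smul (hasFDerivAt_const e x)
  refine (hradial.sub hconst).congr_fderiv (ContinuousLinearMap.ext fun v => ?_)
  simp only [id_eq, real_inner_comm, smul_zero, ContinuousLinearMap.comp_id, zero_add, sub_apply,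
    add_apply, smul_apply, ContinuousLinearMap.id_apply, ContinuousLinearMap.smulRight_apply,
    ContinuousLinearMap.comp_apply, ContinuousLinearMap.prod_apply, zero_apply,
    fderivInnerCLM_apply, inner_zero_right, smul_eq_mul, coe_innerSL_apply, nsmul_eq_mul,
    Nat.cast_ofNat, InnerProductSpace.rankOne_apply]
  module

theorem trace_pinv_comp_fderiv_conformalField [CompleteSpace F] {L : E →L[ℝ] F}
    (hL : Function.Injective L) (e x : F) :
    LinearMap.trace ℝ E (pinv L ∘L fderiv ℝ (conformalField e) x ∘L L) =
      2 * Module.finrank ℝ E * inner ℝ x e := by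
  have hskew : LinearMap.trace ℝ E (pinv L ∘L InnerProductSpace.rankOne ℝ x e ∘L L) =
      LinearMap.trace ℝ E (pinv L ∘L InnerProductSpace.rankOne ℝ e x ∘L L) := by
    rw [trace_pinv_comp_rankOne_comp, trace_pinv_comp_rankOne_comp, inner_map_pinv_comm hL,
      real_inner_comm]
  have hid : pinv L ∘L L = ContinuousLinearMap.id ℝ E :=
    ContinuousLinearMap.ext fun v => pinv_apply_self hL v
  simp only [(hasFDerivAt_conformalField e x).fderiv, ContinuousLinearMap.add_comp,
    ContinuousLinearMap.smul_comp, ContinuousLinearMap.sub_comp, ContinuousLinearMap.comp_add,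
    ContinuousLinearMap.comp_smul, ContinuousLinearMap.comp_sub, ContinuousLinearMap.id_comp, hid,
    ContinuousLinearMap.toLinearMap_add, ContinuousLinearMap.toLinearMap_smul,
    ContinuousLinearMap.toLinearMap_sub, ContinuousLinearMap.coe_id, map_add, map_sub,
    map_smul, hskew, sub_self, LinearMap.trace_id, smul_eq_mul]
  ring

variable {k d : ℕ} [NeZero k] {M : Type*} [TopologicalSpace M]
  [ChartedSpace (EuclideanHalfSpace k) M] {x : M → Euc d}

theorem IsSmoothImmersion.tangentialDivergence_conformalField (hx : IsSmoothImmersion k x)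
    (e : Euc d) (p : M) :
    tangentialDivergence k x (conformalField e ∘ x) p = 2 * k * inner ℝ (x p) e := by
  have hderiv : modelDeriv (𝓡∂ k) (conformalField e ∘ x) p =
      fderiv ℝ (conformalField e) (x p) ∘L modelDeriv (𝓡∂ k) x p :=
    (((contDiff_conformalField e).differentiable one_ne_zero (x p)).hasFDerivAt.hasMFDerivAt.comp p
      (hx.smooth.mdifferentiable (by simp) p).hasMFDerivAt).mfderiv
  rw [tangentialDivergence, hderiv, trace_pinv_comp_fderiv_conformalField (hx.injective_mfderiv p),
    finrank_euclideanSpace_fin]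

variable [T2Space M] [CompactSpace M] [MeasurableSpace M] [BorelSpace M] [IsManifold (𝓡∂ k) ∞ M]

theorem IsSmoothImmersion.integral_inner_eq_zero (hx : IsSmoothImmersion k x)
    (hmin : IsMinimal k x)
    (hν : ∀ p ∈ (𝓡∂ k).boundary M, IsOutwardUnitConormal k x p (x p)) (e : Euc d) :
    ∫ p, inner ℝ (x p) e ∂(areaMeasure k x) = 0 := by
  have hdiv : ∫ p, tangentialDivergence k x (conformalField e ∘ x) p ∂(areaMeasure k x) = 0 :=
    hx.integral_tangentialDivergence_eq_zero hmin
      ((contDiff_conformalField e).contMDiff.comp (hx.smooth.of_le (by norm_cast)))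
      fun p hp => ⟨x p, hν p hp, inner_conformalField_self e (hν p hp).2.1⟩
  simp only [hx.tangentialDivergence_conformalField, integral_const_mul] at hdiv
  exact (mul_eq_zero.1 hdiv).resolve_left
    (mul_ne_zero two_ne_zero (Nat.cast_ne_zero.2 (NeZero.ne k)))

end ConformalField

end FreeBoundary

end

theorem mainTheorem4 {k n : ℕ} [NeZero k] {M : Type*} [TopologicalSpace M] [T2Space M]
    [CompactSpace M] [MeasurableSpace M] [BorelSpace M]
    [ChartedSpace (EuclideanHalfSpace k) M] [IsManifold (𝓡∂ k) ∞ M]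
    (x : M → Euc (n + 1))
    (hx : FreeBoundary.IsSmoothImmersion k x)
    (hmin : FreeBoundary.IsMinimal k x)
    (hfree : FreeBoundary.HasFreeBoundaryInUnitBall k x) :
    MeasureTheory.IsFiniteMeasure (FreeBoundary.areaMeasure k x) ∧
    MeasureTheory.Integrable x (FreeBoundary.areaMeasure k x) ∧
    ∫ p, x p ∂(FreeBoundary.areaMeasure k x) = 0 ∧
    FreeBoundary.massCenter k x = 0 := by
  have hfin := hx.isFiniteMeasure_areaMeasure
  have hint : MeasureTheory.Integrable x (FreeBoundary.areaMeasure k x) :=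
    hx.smooth.continuous.integrable_of_hasCompactSupport (.of_compactSpace x)
  have hzero : ∫ p, x p ∂(FreeBoundary.areaMeasure k x) = 0 := by
    refine ext_inner_left ℝ fun e => ?_
    rw [← integral_inner hint, inner_zero_right]
    simp only [real_inner_comm _ e]
    exact hx.integral_inner_eq_zero hmin hfree.conormal e
  refine ⟨hfin, hint, hzero, ?_⟩
  rw [FreeBoundary.massCenter, MeasureTheory.average_eq, hzero, smul_zero]
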